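/- For positive integers $d_A,d_C$ and $\varepsilon>0$, let $\mathrm{SC}_{\mathrm{I},H}(\varepsilon,d_A,d_C)$ be the least $N$ for which there is a (possibly randomized) test that, given $N$ i.i.d. samples from an unknown probability distribution $P_{AC}$ on $\{1,\dots,d_A\}\times\{1,\dots,d_C\}$, answers "yes" with probability at least $2/3$ whenever $D_H^2(P_{AC},P_AP_C)=0$, and "no" with probability at least $2/3$ whenever $D_H^2(P_{AC},P_AP_C)\ge\varepsilon$. Here $P_A,P_C$ are the marginals of $P_{AC}$ and $D_H^2(P,Q)=\frac12\sum_x\bigl(\sqrt{P(x)}-\sqrt{Q(x)}\bigr)^2$ is the squared Hellinger distance. Then, for $d_A\ge d_C\ge 2$ and all sufficiently small $\varepsilon$, $$\mathrm{SC}_{\mathrm{I},H}(\varepsilon,d_A,d_C)=\widetilde\Omega\left(\min\left\{\frac{d_A^{3/4}d_C^{1/4}}{\varepsilon},\ \frac{d_A^{2/3}d_C^{1/3}}{\varepsilon^{4/3}}\right\}\right),$$ where $\widetilde\Omega$ hides factors that are poly-logarithmic in the parameters. That is, there are absolute constants $c>0$, $k\in\mathbb{N}$ and $\varepsilon_0\in(0,1]$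 such that for all integers $d_A\ge d_C\ge 2$ and all $0<\varepsilon\le\varepsilon_0$, $$\mathrm{SC}_{\mathrm{I},H}(\varepsilon,d_A,d_C)\ \ge\ \frac{c}{\log^{k}(d_Ad_C/\varepsilon)}\,\min\left\{\frac{d_A^{3/4}d_C^{1/4}}{\varepsilon},\ \frac{d_A^{2/3}d_C^{1/3}}{\varepsilon^{4/3}}\right\}.$$ -/

import Mathlib

open scoped ENNReal

noncomputable section

namespace IndependenceTesting

/-- Marginal `P_A` of a joint distribution `P_{AC}`. -/
def marginalA {A C : Type*} [Fintype C] (P : A × C → ℝ) (a : A) : ℝ := ∑ c, P (a, c)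

/-- Marginal `P_C` of a joint distribution `P_{AC}`. -/
def marginalC {A C : Type*} [Fintype A] (P : A × C → ℝ) (c : C) : ℝ := ∑ a, P (a, c)

/-- The product `P_A P_C` of the two marginals of `P_{AC}`. -/
def marginalProduct {A C : Type*} [Fintype A] [Fintype C] (P : A × C → ℝ) : A × C → ℝ :=
  fun x => marginalA P x.1 * marginalC P x.2

/-- Squared Hellinger distance
`D_H²(P, Q) = (1/2) ∑ x, (√(P x) - √(Q x))²` of two distributions on a finite set. -/
def hellingerSq {D : Type*} [Fintype D] (P Q : D → ℝ) : ℝ :=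
  (1 / 2) * ∑ x, (√(P x) - √(Q x)) ^ 2

/-- A (randomized) test on `N` samples from `D`: it maps the list of samples to the
probability with which the answer is "yes" ("no" has the complementary probability). -/
def RandomizedTest (D : Type*) (N : ℕ) : Type _ := (Fin N → D) → Set.Icc (0 : ℝ) 1

/-- The probability that the test answers "yes" on `N` i.i.d. samples from `P`; the randomness is
that of the samples and that of the test. -/
def yesProb {D : Type*} [Fintype D] {N : ℕ} (P : D → ℝ) (T : RandomizedTest D N) : ℝ :=
  ∑ x : Fin N → D, (∏ i, P (x i)) * (T x : ℝ)

/-- `T` is an independence tester in squared Hellinger distance with threshold `ε`: for every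
distribution `P` on `A × C`, with probability at least `2/3`, it answers "yes" if
`D_H²(P, P_A P_C) = 0` and "no" if `D_H²(P, P_A P_C) ≥ ε`. -/
def IsIndependenceTester {A C : Type*} [Fintype A] [Fintype C] {N : ℕ} (ε : ℝ)
    (T : RandomizedTest (A × C) N) : Prop :=
  ∀ P ∈ stdSimplex ℝ (A × C),
    (hellingerSq P (marginalProduct P) = 0 → 2 / 3 ≤ yesProb P T) ∧
    (ε ≤ hellingerSq P (marginalProduct P) → 2 / 3 ≤ 1 - yesProb P T)

/-- The sample complexity `SC_{I,H}(ε, d_A, d_C)`: the least `N` for which there is an independence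
tester on `N` samples (it would be `⊤` if there were none). -/
def sampleComplexity (ε : ℝ) (dA dC : ℕ) : ℕ∞ :=
  ⨅ (N : ℕ) (_ : ∃ T : RandomizedTest (Fin dA × Fin dC) N, IsIndependenceTester ε T), (N : ℕ∞)

end IndependenceTesting

end

/-!
Take a Poissonized table of counts with independent rows. A light row has total mean `l`, spread
under the null hypothesis uniformly over the columns `K × Bool`; under the alternative, one column
of each pair `(k, true)`, `(k, false)`, chosen at random for each row, is emptied and the other one
doubled. With probability `p` a row is heavy instead: uniform of total mean `1` under both
hypotheses. One further row, uniform of large mean `R`, makes the column marginal nearly uniform, so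
that the emptied cells alone put the alternative at squared Hellinger distance of order
`card A * l / R` from the product of its marginals, provided the heavy rows are few.

Averaged over its pattern, an alternative light row is indistinguishable from a null one until it
receives two samples, which has probability of order `l ^ 2`; and even then the likelihood ratio
exceeds `1` only by the effect of coincidences within one pair of columns. The heavy rows keep the
null likelihood of such counts above a multiple of `p`, so the `χ²` divergence of a row is at most
of order `l ^ 4 / (p * card K)`, and it tensorizes over the `card A` rows. The two mixtures cannot
be told apart as long as the total stays below a small constant; taking `l` of order
`R * ε / card A` and `p` of order `min R (card A) / card A`, this is the claimed range of `R`.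
-/

namespace IndependenceTesting

open Finset
open scoped BigOperators

section ProductSums

variable {ι : Type*} [Fintype ι]

theorem sum_pi_prod [DecidableEq ι] {R Ω : Type*} [CommSemiring R] [Fintype Ω] (f : ι → Ω → R) :
    ∑ ω : ι → Ω, ∏ i, f i (ω i) = ∏ i, ∑ a, f i a := by
  rw [prod_univ_sum, Fintype.piFinset_univ]

theorem sum_pi_prod_eq_one [DecidableEq ι] {R Ω : Type*} [CommSemiring R] [Fintype Ω] {π : Ω → R}
    (hπ : ∑ a, π a = 1) : ∑ ω : ι → Ω, ∏ i, π (ω i) = 1 := by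
  rw [sum_pi_prod fun _ => π, hπ, prod_const_one]

theorem sum_pi_prod_mul_apply [DecidableEq ι] {R Ω : Type*} [CommSemiring R] [Fintype Ω]
    {π : Ω → R} (hπ : ∑ a, π a = 1) (f : Ω → R) (i : ι) :
    ∑ ω : ι → Ω, (∏ j, π (ω j)) * f (ω i) = ∑ a, π a * f a := by
  have factor (ω : ι → Ω) :
      (∏ j, π (ω j)) * f (ω i) = ∏ j, π (ω j) * (if j = i then f (ω j) else 1) := by
    rw [prod_mul_distrib, prod_ite_eq' univ i, if_pos (mem_univ i)]
  simp_rw [factor, sum_pi_prod fun j a => π a * if j = i then f a else 1]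
  rw [Fintype.prod_eq_single i fun j hj => by simpa [hj] using hπ]
  simp

theorem hasSum_pi_prod_of_nonneg {E : Type*} {f : ι → E → ℝ} {s : ι → ℝ}
    (hf : ∀ i e, 0 ≤ f i e) (hs : ∀ i, HasSum (f i) (s i)) :
    HasSum (fun k : ι → E => ∏ i, f i (k i)) (∏ i, s i) := by
  suffices fin_case : ∀ {n : ℕ} {f : Fin n → E → ℝ} {s : Fin n → ℝ}, (∀ i e, 0 ≤ f i e) →
      (∀ i, HasSum (f i) (s i)) → HasSum (fun k : Fin n → E => ∏ i, f i (k i)) (∏ i, s i) by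
    let e := Fintype.equivFin ι
    have reindexed := fin_case (fun i => hf (e.symm i)) fun i => hs (e.symm i)
    rw [← (e.symm.arrowCongr (Equiv.refl E)).hasSum_iff, ← e.symm.prod_comp]
    refine reindexed.congr_fun fun k => ?_
    simp [← e.symm.prod_comp]
  intro n
  induction n with
  | zero => intro f s _ _; simp
  | succ n ih =>
    intro f s hf hs
    have tail := ih (fun i => hf (Fin.succ i)) fun i => hs (Fin.succ i)
    have tail_nonneg (k : Fin n → E) : 0 ≤ ∏ i, f (Fin.succ i) (k i) :=
      prod_nonneg fun i _ => hf _ _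
    have product := (hs 0).summable.mul_of_nonneg tail.summable (hf 0) tail_nonneg
    rw [← (Fin.consEquiv fun _ => E).hasSum_iff, Fin.prod_univ_succ]
    exact ((hs 0).mul tail product).congr_fun fun k => by simp [Fin.prod_univ_succ]

end ProductSums

section PoissonWeight

/-- The probability that a Poisson variable of mean `x` equals `n`. The mean is a real number, so
that the weights can be handled as an analytic expression in it; they are probabilities only if
`0 ≤ x`. -/
noncomputable def poissonWeight (x : ℝ) (n : ℕ) : ℝ := Real.exp (-x) * x ^ n / n.factorial

variable {x : ℝ}

theorem poissonWeight_nonneg (hx : 0 ≤ x) (n : ℕ) : 0 ≤ poissonWeight x n := by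
  unfold poissonWeight
  positivity

theorem poissonWeight_pos (hx : 0 < x) (n : ℕ) : 0 < poissonWeight x n := by
  unfold poissonWeight
  positivity

theorem hasSum_poissonWeight_mul_pow (x y : ℝ) :
    HasSum (fun n => poissonWeight x n * y ^ n) (Real.exp (x * (y - 1))) := by
  have series := (NormedSpace.expSeries_div_hasSum_exp (x * y)).mul_left (Real.exp (-x))
  rw [← Real.exp_eq_exp_ℝ, ← Real.exp_add, show -x + x * y = x * (y - 1) by ring] at series
  refine series.congr_fun fun n => ?_
  rw [poissonWeight, mul_pow]
  ring

theorem hasSum_poissonWeight (x : ℝ) : HasSum (poissonWeight x) 1 := by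
  simpa using hasSum_poissonWeight_mul_pow x 1

theorem sum_poissonWeight_mul_pow_le (hx : 0 ≤ x) {s : ℝ} (hs₀ : 0 ≤ s) (hs₁ : s ≤ 1) (N : ℕ) :
    (∑ M ∈ range N, poissonWeight x M) * s ^ N ≤ Real.exp (x * (s - 1)) := by
  calc (∑ M ∈ range N, poissonWeight x M) * s ^ N
      ≤ ∑ M ∈ range N, poissonWeight x M * s ^ M := by
        rw [sum_mul]
        refine sum_le_sum fun M hM => mul_le_mul_of_nonneg_left ?_ (poissonWeight_nonneg hx M)
        exact pow_le_pow_of_le_one hs₀ hs₁ (mem_range.1 hM).le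
    _ ≤ Real.exp (x * (s - 1)) := sum_le_hasSum _
        (fun M _ => mul_nonneg (poissonWeight_nonneg hx M) (pow_nonneg hs₀ M))
        (hasSum_poissonWeight_mul_pow x s)

theorem sum_poissonWeight_le_one_sixth {N : ℕ} (hx : 2 * (N : ℝ) + 10 ≤ x) :
    ∑ M ∈ range N, poissonWeight x M ≤ 1 / 6 := by
  have chernoff := sum_poissonWeight_mul_pow_le (s := 1 / 2) (by linarith [N.cast_nonneg (α := ℝ)])
    (by norm_num) (by norm_num) N
  have two_pow_le : (2 : ℝ) ^ N ≤ Real.exp N := by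
    rw [← Real.exp_one_pow]
    exact pow_le_pow_left₀ (by norm_num) (by linarith [Real.add_one_le_exp 1]) N
  calc ∑ M ∈ range N, poissonWeight x M
      = (∑ M ∈ range N, poissonWeight x M) * (1 / 2) ^ N * 2 ^ N := by
        rw [mul_assoc, ← mul_pow]
        norm_num
    _ ≤ Real.exp (x * (1 / 2 - 1)) * Real.exp N := by gcongr
    _ ≤ Real.exp (-5) := by
        rw [← Real.exp_add]
        exact Real.exp_le_exp.2 (by linarith)
    _ ≤ 1 / 6 := by
        rw [Real.exp_neg, ← one_div]
        exact one_div_le_one_div_of_le (by norm_num) (by linarith [Real.add_one_le_exp 5])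

end PoissonWeight

section Poissonization

variable {D : Type*} {M N : ℕ}

/-- The number of entries of the sample sequence `x` that are equal to `d`. -/
def sampleCount [DecidableEq D] (x : Fin M → D) (d : D) : ℕ := #{i | x i = d}

/-- Sample sequences of arbitrary length. -/
abbrev SampleSequence (D : Type*) : Type _ := Σ M : ℕ, Fin M → D

/-- The acceptance probability of `T` when it is run on the first `N` entries of a sequence of
random length; sequences with fewer than `N` entries are rejected. -/
def acceptProb (T : RandomizedTest D N) (x : SampleSequence D) : ℝ :=
  if h : N ≤ x.1 then T fun i => x.2 (Fin.castLE h i) else 0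

theorem acceptProb_nonneg (T : RandomizedTest D N) (x : SampleSequence D) : 0 ≤ acceptProb T x := by
  unfold acceptProb
  split_ifs
  exacts [(T _).2.1, le_rfl]

theorem acceptProb_le_one (T : RandomizedTest D N) (x : SampleSequence D) :
    acceptProb T x ≤ 1 := by
  unfold acceptProb
  split_ifs
  exacts [(T _).2.2, zero_le_one]

variable [Fintype D]

theorem sum_prod_mul_castLE {R : Type*} [CommSemiring R] (h : N ≤ M) {P : D → R}
    (hP : ∑ d, P d = 1) (g : (Fin N → D) → R) :
    ∑ x : Fin M → D, (∏ i, P (x i)) * g (fun i => x (Fin.castLE h i)) =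
      ∑ y : Fin N → D, (∏ i, P (y i)) * g y := by
  obtain ⟨j, rfl⟩ := Nat.exists_eq_add_of_le h
  have sum_suffix : ∑ z : Fin j → D, ∏ i, P (z i) = 1 := by
    rw [sum_pi_prod fun _ => P]
    simp [hP]
  rw [← (Fin.appendEquiv N j).sum_comp, Fintype.sum_prod_type]
  refine sum_congr rfl fun y _ => ?_
  have split (z : Fin j → D) : (∏ i, P (Fin.append y z i)) *
      g (fun i => Fin.append y z (Fin.castAdd j i)) = ((∏ i, P (y i)) * g y) * ∏ i, P (z i) := by
    simp only [Fin.prod_univ_add, Fin.append_left, Fin.append_right]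
    ring
  calc _ = ∑ z : Fin j → D, ((∏ i, P (y i)) * g y) * ∏ i, P (z i) :=
        sum_congr rfl fun z _ => split z
    _ = (∏ i, P (y i)) * g y := by rw [← mul_sum, sum_suffix, mul_one]

theorem sum_prod_mul_acceptProb {P : D → ℝ} (hP : ∑ d, P d = 1) (T : RandomizedTest D N) (M : ℕ) :
    ∑ x : Fin M → D, (∏ i, P (x i)) * acceptProb T ⟨M, x⟩ = if N ≤ M then yesProb P T else 0 := by
  split_ifs with h
  · simpa only [acceptProb, dif_pos h, yesProb] using sum_prod_mul_castLE h hP fun y => (T y : ℝ)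
  · simp [acceptProb, h]

/-- The joint law of independent Poisson counts of means `μ d`. -/
noncomputable def poissonLaw (μ : D → ℝ) (k : D → ℕ) : ℝ :=
  ∏ d, poissonWeight (μ d) (k d)

theorem poissonLaw_nonneg {μ : D → ℝ} (hμ : ∀ d, 0 ≤ μ d) (k : D → ℕ) :
    0 ≤ poissonLaw μ k :=
  prod_nonneg fun d _ => poissonWeight_nonneg (hμ d) _

theorem hasSum_poissonLaw {μ : D → ℝ} (hμ : ∀ d, 0 ≤ μ d) : HasSum (poissonLaw μ) 1 := by
  simpa only [prod_const_one] using! hasSum_pi_prod_of_nonneg (fun d => poissonWeight_nonneg (hμ d))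
    fun d => hasSum_poissonWeight (μ d)

/-- The probability distribution proportional to `μ`. -/
noncomputable def normalize (μ : D → ℝ) (d : D) : ℝ := μ d / ∑ e, μ e

theorem normalize_mem_stdSimplex {μ : D → ℝ} (hμ : ∀ d, 0 ≤ μ d) (hpos : 0 < ∑ d, μ d) :
    normalize μ ∈ stdSimplex ℝ D :=
  ⟨fun d => div_nonneg (hμ d) hpos.le, by
    simp only [normalize]
    rw [← sum_div, div_self hpos.ne']⟩

theorem yesProb_nonneg {P : D → ℝ} (hP : P ∈ stdSimplex ℝ D) (T : RandomizedTest D N) :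
    0 ≤ yesProb P T :=
  sum_nonneg fun x _ => mul_nonneg (prod_nonneg fun i _ => hP.1 (x i)) (T x).2.1

theorem yesProb_le_one {P : D → ℝ} (hP : P ∈ stdSimplex ℝ D) (T : RandomizedTest D N) :
    yesProb P T ≤ 1 :=
  calc yesProb P T ≤ ∑ x : Fin N → D, ∏ i, P (x i) := sum_le_sum fun x _ =>
        mul_le_of_le_one_right (prod_nonneg fun i _ => hP.1 (x i)) (T x).2.2
    _ = 1 := sum_pi_prod_eq_one hP.2

variable [DecidableEq D]

theorem sum_sampleCount (x : Fin M → D) : ∑ d, sampleCount x d = M := by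
  simp only [sampleCount]
  rw [← card_eq_sum_card_fiberwise fun i _ => mem_univ (x i), card_univ, Fintype.card_fin]

theorem prod_comp_eq_prod_pow_sampleCount {R : Type*} [CommMonoid R] (x : Fin M → D) (f : D → R) :
    ∏ i, f (x i) = ∏ d, f d ^ sampleCount x d := by
  rw [← prod_fiberwise' univ x f]
  simp only [prod_const, sampleCount]

/-- The finite set of all sample sequences with counts `k`. -/
def orderings (k : D → ℕ) : Finset (SampleSequence D) :=
  ({x | sampleCount x = k} : Finset (Fin (∑ d, k d) → D)).map (.sigmaMk (∑ d, k d))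

theorem mem_orderings {k : D → ℕ} {x : SampleSequence D} :
    x ∈ orderings k ↔ sampleCount x.2 = k := by
  obtain ⟨M, x⟩ := x
  simp only [orderings, mem_map, mem_filter_univ, Function.Embedding.sigmaMk_apply]
  constructor
  · rintro ⟨y, hy, heq⟩
    cases heq
    exact hy
  · rintro rfl
    rw [sum_sampleCount]
    exact ⟨x, rfl, rfl⟩

theorem card_orderings (k : D → ℕ) : #(orderings k) = Nat.multinomial univ k := by
  set M := ∑ d, k d with hM
  have expand : (∑ d : D, MvPolynomial.X d : MvPolynomial D ℕ) ^ M =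
      ∑ x : Fin M → D, MvPolynomial.monomial (Finsupp.equivFunOnFinite.symm (sampleCount x)) 1 := by
    rw [Fintype.sum_pow]
    refine sum_congr rfl fun x _ => ?_
    rw [prod_comp_eq_prod_pow_sampleCount x, MvPolynomial.monomial_eq, map_one, one_mul,
      Finsupp.prod_fintype _ _ fun _ => pow_zero _]
    rfl
  have coeff := MvPolynomial.coeff_sum_X_pow_of_fintype (R := ℕ)
    (Finsupp.equivFunOnFinite.symm k) M
  rw [expand, MvPolynomial.coeff_sum, Finsupp.sum_fintype _ _ fun _ => rfl,
    Finsupp.coe_equivFunOnFinite_symm, if_pos hM.symm, Nat.cast_id,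
    Finsupp.multinomial_eq_of_support_subset (subset_univ _)] at coeff
  simpa only [MvPolynomial.coeff_monomial, EmbeddingLike.apply_eq_iff_eq, orderings, card_map,
    card_filter, Finsupp.coe_equivFunOnFinite_symm] using coeff

/-- The law on sample sequences that draws the counts from `G` and then orders the samples
uniformly at random. -/
noncomputable def shuffle (G : (D → ℕ) → ℝ) (x : SampleSequence D) : ℝ :=
  G (sampleCount x.2) / Nat.multinomial univ (sampleCount x.2)

theorem shuffle_nonneg {G : (D → ℕ) → ℝ} (hG : ∀ k, 0 ≤ G k) (x : SampleSequence D) :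
    0 ≤ shuffle G x :=
  div_nonneg (hG _) (Nat.cast_nonneg _)

theorem shuffle_pos {G : (D → ℕ) → ℝ} (hG : ∀ k, 0 < G k) (x : SampleSequence D) :
    0 < shuffle G x :=
  div_pos (hG _) (Nat.cast_pos.2 (Nat.multinomial_pos _ _))

theorem sum_orderings_shuffle (G : (D → ℕ) → ℝ) (k : D → ℕ) :
    ∑ x ∈ orderings k, shuffle G x = G k := by
  have shuffle_eq (x) (hx : x ∈ orderings k) : shuffle G x = G k / Nat.multinomial univ k := by
    rw [shuffle, mem_orderings.1 hx]
  have pos := Nat.multinomial_pos univ k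
  rw [sum_congr rfl shuffle_eq, sum_const, card_orderings, nsmul_eq_mul]
  field_simp

theorem hasSum_shuffle {G : (D → ℕ) → ℝ} (hG : ∀ k, 0 ≤ G k) {s : ℝ} (hs : HasSum G s) :
    HasSum (shuffle G) s := by
  have partition (x : SampleSequence D) : ∃! k, x ∈ (orderings k : Set (SampleSequence D)) :=
    ⟨sampleCount x.2, mem_orderings.2 rfl, fun k hk => (mem_orderings.1 hk).symm⟩
  have fiber (k : D → ℕ) : HasSum (fun x : (orderings k : Set (SampleSequence D)) => shuffle G x)
      (G k) := by
    simpa only [sum_orderings_shuffle] using! (orderings k).hasSum (shuffle G)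
  have summable : Summable (shuffle G) := by
    rw [summable_partition (shuffle_nonneg hG) partition]
    exact ⟨fun k => (fiber k).summable, hs.summable.congr fun k => (fiber k).tsum_eq.symm⟩
  rw [← (Set.sigmaEquiv _ partition).hasSum_iff]
  exact hs.sigma_of_hasSum fiber ((Set.sigmaEquiv _ partition).summable_iff.2 summable)

theorem shuffle_poissonLaw {μ : D → ℝ} (hμ : ∑ d, μ d ≠ 0) (x : SampleSequence D) :
    shuffle (poissonLaw μ) x = poissonWeight (∑ d, μ d) x.1 * ∏ i, normalize μ (x.2 i) := by
  have spec : (∏ d, ((sampleCount x.2 d).factorial : ℝ)) *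
      Nat.multinomial univ (sampleCount x.2) = x.1.factorial := by
    exact_mod_cast (Nat.multinomial_spec univ (sampleCount x.2)).trans
      (congrArg _ (sum_sampleCount x.2))
  have law : poissonLaw μ (sampleCount x.2) = Real.exp (-∑ d, μ d) *
      (∏ i, μ (x.2 i)) / ∏ d, ((sampleCount x.2 d).factorial : ℝ) := by
    simp only [poissonLaw, poissonWeight]
    rw [prod_div_distrib, prod_mul_distrib, ← Real.exp_sum, sum_neg_distrib,
      prod_comp_eq_prod_pow_sampleCount x.2]
  have product : ∏ i, normalize μ (x.2 i) = (∏ i, μ (x.2 i)) / (∑ d, μ d) ^ x.1 := by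
    simp only [normalize]
    rw [prod_div_distrib, prod_const, card_univ, Fintype.card_fin]
  rw [shuffle, law, product, poissonWeight, ← spec]
  have := pow_ne_zero x.1 hμ
  field_simp

/-- The probability that `T` answers "yes" when the number of samples equal to `d` is an
independent Poisson variable of mean `μ d`. -/
noncomputable def poissonYesProb (μ : D → ℝ) (T : RandomizedTest D N) : ℝ :=
  ∑' x, shuffle (poissonLaw μ) x * acceptProb T x

theorem hasSum_poissonYesProb {μ : D → ℝ} (hμ : ∀ d, 0 ≤ μ d) (T : RandomizedTest D N) :
    HasSum (fun x => shuffle (poissonLaw μ) x * acceptProb T x) (poissonYesProb μ T) := by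
  have law_nonneg := shuffle_nonneg (poissonLaw_nonneg hμ)
  exact (Summable.of_nonneg_of_le (fun x => mul_nonneg (law_nonneg x) (acceptProb_nonneg T x))
    (fun x => mul_le_of_le_one_right (law_nonneg x) (acceptProb_le_one T x))
    (hasSum_shuffle (poissonLaw_nonneg hμ) (hasSum_poissonLaw hμ)).summable).hasSum

theorem poissonYesProb_eq {μ : D → ℝ} (hμ : ∀ d, 0 ≤ μ d) (hpos : 0 < ∑ d, μ d)
    (T : RandomizedTest D N) :
    poissonYesProb μ T = yesProb (normalize μ) T *
      (1 - ∑ M ∈ range N, poissonWeight (∑ d, μ d) M) := by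
  have level (M : ℕ) : HasSum (fun x : Fin M → D =>
      shuffle (poissonLaw μ) ⟨M, x⟩ * acceptProb T ⟨M, x⟩)
      (poissonWeight (∑ d, μ d) M * if N ≤ M then yesProb (normalize μ) T else 0) := by
    rw [← sum_prod_mul_acceptProb (normalize_mem_stdSimplex hμ hpos).2, mul_sum]
    simpa only [shuffle_poissonLaw hpos.ne', mul_assoc] using hasSum_fintype _
  refine ((hasSum_poissonYesProb hμ T).sigma level).unique ?_
  have head : ∑ M ∈ range N,
      poissonWeight (∑ d, μ d) M * (if N ≤ M then yesProb (normalize μ) T else 0) = 0 :=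
    sum_eq_zero fun M hM => by rw [if_neg (mem_range.1 hM).not_ge, mul_zero]
  rw [← hasSum_nat_add_iff' N, head, sub_zero, mul_comm]
  simpa using ((hasSum_nat_add_iff' N).2 (hasSum_poissonWeight (∑ d, μ d))).mul_right
    (yesProb (normalize μ) T)

theorem poissonYesProb_le_yesProb {μ : D → ℝ} (hμ : ∀ d, 0 ≤ μ d) (hpos : 0 < ∑ d, μ d)
    (T : RandomizedTest D N) : poissonYesProb μ T ≤ yesProb (normalize μ) T := by
  rw [poissonYesProb_eq hμ hpos]
  exact mul_le_of_le_one_right (yesProb_nonneg (normalize_mem_stdSimplex hμ hpos) T)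
    (sub_le_self _ (sum_nonneg fun M _ => poissonWeight_nonneg hpos.le M))

theorem yesProb_mul_le_poissonYesProb {μ : D → ℝ} (hμ : ∀ d, 0 ≤ μ d)
    (hN : 2 * (N : ℝ) + 10 ≤ ∑ d, μ d) (T : RandomizedTest D N) :
    yesProb (normalize μ) T * (5 / 6) ≤ poissonYesProb μ T := by
  have hpos : 0 < ∑ d, μ d := by linarith [N.cast_nonneg (α := ℝ)]
  rw [poissonYesProb_eq hμ hpos]
  exact mul_le_mul_of_nonneg_left (by linarith [sum_poissonWeight_le_one_sixth hN])
    (yesProb_nonneg (normalize_mem_stdSimplex hμ hpos) T)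

end Poissonization

section ChiSquare

variable {E : Type*} {q₀ q₁ : E → ℝ} {χ : ℝ}

/-- The `χ²` divergence of `q₁` from `q₀` is at most `χ`, for nonnegative weights `q₀` and `q₁` of
total mass `1`. The divergence `∑ q₁² / q₀ - 1` may be infinite, so it is bounded rather than
defined; where `q₀` vanishes the quotient is `0`, so the bound is meaningful for positive `q₀`. -/
def ChiSqLE (q₀ q₁ : E → ℝ) (χ : ℝ) : Prop :=
  ∃ S ≤ 1 + χ, HasSum (fun e => q₁ e ^ 2 / q₀ e) S

theorem ChiSqLE.mono {χ' : ℝ} (h : ChiSqLE q₀ q₁ χ) (hχ : χ ≤ χ') : ChiSqLE q₀ q₁ χ' :=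
  let ⟨S, hS, hsum⟩ := h
  ⟨S, by linarith, hsum⟩

theorem chiSqLE_self (hq : HasSum q₀ 1) : ChiSqLE q₀ q₀ 0 :=
  ⟨1, by norm_num, hq.congr_fun fun e => by rw [sq, mul_self_div_self]⟩

theorem chiSqLE_of_sq_sub_le {u : E → ℝ} (hq₀ : ∀ e, 0 < q₀ e) (hsum₀ : HasSum q₀ 1)
    (hsum₁ : HasSum q₁ 1) (hu : ∀ e, (q₁ e - q₀ e) ^ 2 ≤ u e * q₀ e) (hχ : HasSum u χ) :
    ChiSqLE q₀ q₁ χ := by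
  have bound (e : E) : (q₁ e - q₀ e) ^ 2 / q₀ e ≤ u e := (div_le_iff₀ (hq₀ e)).2 (hu e)
  have summable : Summable fun e => (q₁ e - q₀ e) ^ 2 / q₀ e :=
    .of_nonneg_of_le (fun e => div_nonneg (sq_nonneg _) (hq₀ e).le) bound hχ.summable
  refine ⟨∑' e, (q₁ e - q₀ e) ^ 2 / q₀ e + (2 * 1 - 1), ?_,
    (summable.hasSum.add ((hsum₁.mul_left 2).sub hsum₀)).congr_fun fun e => ?_⟩
  · linarith [hasSum_le bound summable.hasSum hχ]
  · field_simp [(hq₀ e).ne']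
    ring

theorem ChiSqLE.pi {ι : Type*} [Fintype ι] {q₀ q₁ : ι → E → ℝ} (hq₀ : ∀ i e, 0 ≤ q₀ i e)
    (h : ∀ i, ChiSqLE (q₀ i) (q₁ i) χ) :
    ChiSqLE (fun k : ι → E => ∏ i, q₀ i (k i)) (fun k => ∏ i, q₁ i (k i))
      (Real.exp (Fintype.card ι * χ) - 1) := by
  choose S hS hsum using h
  have S_nonneg (i : ι) : 0 ≤ S i :=
    (hsum i).nonneg fun e => div_nonneg (sq_nonneg _) (hq₀ i e)
  refine ⟨∏ i, S i, ?_, (hasSum_pi_prod_of_nonneg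
    (fun i e => div_nonneg (sq_nonneg _) (hq₀ i e)) hsum).congr_fun fun k => ?_⟩
  · calc ∏ i, S i ≤ ∏ _i : ι, Real.exp χ := prod_le_prod (fun i _ => S_nonneg i) fun i _ =>
          (hS i).trans (by linarith [Real.add_one_le_exp χ])
      _ = 1 + (Real.exp (Fintype.card ι * χ) - 1) := by
          rw [prod_const, card_univ, ← Real.exp_nat_mul]
          ring
  · rw [prod_div_distrib, prod_pow]

theorem ChiSqLE.comp_equiv {F : Type*} (h : ChiSqLE q₀ q₁ χ) (e : F ≃ E) :
    ChiSqLE (q₀ ∘ e) (q₁ ∘ e) χ :=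
  let ⟨S, hS, hsum⟩ := h
  ⟨S, hS, e.hasSum_iff.2 hsum⟩

theorem ChiSqLE.shuffle {D : Type*} [Fintype D] [DecidableEq D] {G₀ G₁ : (D → ℕ) → ℝ}
    (h : ChiSqLE G₀ G₁ χ) (hG₀ : ∀ k, 0 ≤ G₀ k) : ChiSqLE (shuffle G₀) (shuffle G₁) χ := by
  obtain ⟨S, hS, hsum⟩ := h
  refine ⟨S, hS, (hasSum_shuffle (fun k => div_nonneg (sq_nonneg _) (hG₀ k)) hsum).congr_fun
    fun x => ?_⟩
  have := Nat.multinomial_pos univ (sampleCount x.2)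
  simp only [IndependenceTesting.shuffle]
  field_simp

theorem sub_mul_le_add_sq_div {a b g δ : ℝ} (ha : 0 < a) (hδ : 0 < δ) (hg₀ : 0 ≤ g)
    (hg₁ : g ≤ 1) : (a - b) * g ≤ δ / 2 * a + (b - a) ^ 2 / a / (2 * δ) := by
  have amgm : a - b ≤ δ / 2 * a + (b - a) ^ 2 / a / (2 * δ) := by
    rw [← sub_nonneg]
    have complete_square : δ / 2 * a + (b - a) ^ 2 / a / (2 * δ) - (a - b) =
        (δ * a - (a - b)) ^ 2 / (2 * δ * a) := by
      field_simp
      ring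
    rw [complete_square]
    positivity
  have rhs_nonneg : 0 ≤ δ / 2 * a + (b - a) ^ 2 / a / (2 * δ) := by positivity
  nlinarith

theorem ChiSqLE.sub_le {δ : ℝ} (h : ChiSqLE q₀ q₁ (δ ^ 2)) (hδ : 0 < δ) (hq₀ : ∀ e, 0 < q₀ e)
    (hsum₀ : HasSum q₀ 1) (hsum₁ : HasSum q₁ 1) {g : E → ℝ} (hg₀ : ∀ e, 0 ≤ g e)
    (hg₁ : ∀ e, g e ≤ 1) {s₀ s₁ : ℝ} (hs₀ : HasSum (fun e => q₀ e * g e) s₀)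
    (hs₁ : HasSum (fun e => q₁ e * g e) s₁) : s₀ - s₁ ≤ δ := by
  obtain ⟨S, hS, hsum⟩ := h
  have hsum_sq : HasSum (fun e => (q₁ e - q₀ e) ^ 2 / q₀ e) (S - 2 * 1 + 1) :=
    ((hsum.sub (hsum₁.mul_left 2)).add hsum₀).congr_fun fun e => by
      field_simp [(hq₀ e).ne']
      ring
  have bound := hasSum_le (fun e => sub_mul_le_add_sq_div (b := q₁ e) (hq₀ e) hδ (hg₀ e) (hg₁ e))
    ((hs₀.sub hs₁).congr_fun fun e => sub_mul _ _ _)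
    ((hsum₀.mul_left (δ / 2)).add (hsum_sq.div_const (2 * δ)))
  calc s₀ - s₁ ≤ δ / 2 * 1 + (S - 2 * 1 + 1) / (2 * δ) := bound
    _ ≤ δ / 2 * 1 + (1 + δ ^ 2 - 2 * 1 + 1) / (2 * δ) := by gcongr
    _ = δ := by
        field_simp
        ring

end ChiSquare

section RowMixture

variable {A C Ω : Type*} [Fintype A] [Fintype C] [Fintype Ω] {π : Ω → ℝ}

/-- The law of a row of independent Poisson counts whose means `v ω` depend on a random state `ω`
with distribution `π`. -/
noncomputable def rowLaw (π : Ω → ℝ) (v : Ω → C → ℝ) (κ : C → ℕ) : ℝ :=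
  ∑ ω, π ω * poissonLaw (v ω) κ

theorem hasSum_rowLaw (hπ₁ : ∑ ω, π ω = 1) {v : Ω → C → ℝ} (hv : ∀ ω c, 0 ≤ v ω c) :
    HasSum (rowLaw π v) 1 := by
  simpa only [mul_one, hπ₁] using!
    hasSum_sum (s := univ) fun ω _ => (hasSum_poissonLaw (hv ω)).mul_left (π ω)

theorem rowLaw_nonneg (hπ : ∀ ω, 0 ≤ π ω) {v : Ω → C → ℝ} (hv : ∀ ω c, 0 ≤ v ω c) (κ : C → ℕ) :
    0 ≤ rowLaw π v κ :=
  sum_nonneg fun ω _ => mul_nonneg (hπ ω) (poissonLaw_nonneg (hv ω) κ)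

theorem rowLaw_pos (hπ : ∀ ω, 0 ≤ π ω) (hπ₁ : ∑ ω, π ω = 1) {v : Ω → C → ℝ}
    (hv : ∀ ω c, 0 < v ω c) (κ : C → ℕ) : 0 < rowLaw π v κ := by
  have law_pos (ω : Ω) : 0 < poissonLaw (v ω) κ := prod_pos fun c _ => poissonWeight_pos (hv ω c) _
  obtain ⟨ω, -, hω⟩ : ∃ ω ∈ univ, π ω ≠ 0 := exists_ne_zero_of_sum_ne_zero (by rw [hπ₁]; norm_num)
  exact sum_pos' (fun ω _ => mul_nonneg (hπ ω) (law_pos ω).le)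
    ⟨ω, mem_univ ω, mul_pos ((hπ ω).lt_of_ne' hω) (law_pos ω)⟩

/-- The law of a table of counts with independent rows, row `a` having law `rowLaw π (v a)`. -/
noncomputable def tableLaw (π : Ω → ℝ) (v : A → Ω → C → ℝ) (k : A × C → ℕ) : ℝ :=
  ∏ a, rowLaw π (v a) fun c => k (a, c)

theorem tableLaw_nonneg (hπ : ∀ ω, 0 ≤ π ω) {v : A → Ω → C → ℝ} (hv : ∀ a ω c, 0 ≤ v a ω c)
    (k : A × C → ℕ) : 0 ≤ tableLaw π v k :=
  prod_nonneg fun a _ => rowLaw_nonneg hπ (hv a) _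

theorem tableLaw_pos (hπ : ∀ ω, 0 ≤ π ω) (hπ₁ : ∑ ω, π ω = 1) {v : A → Ω → C → ℝ}
    (hv : ∀ a ω c, 0 < v a ω c) (k : A × C → ℕ) : 0 < tableLaw π v k :=
  prod_pos fun a _ => rowLaw_pos hπ hπ₁ (hv a) _

theorem hasSum_tableLaw (hπ : ∀ ω, 0 ≤ π ω) (hπ₁ : ∑ ω, π ω = 1) {v : A → Ω → C → ℝ}
    (hv : ∀ a ω c, 0 ≤ v a ω c) : HasSum (tableLaw π v) 1 := by
  have := hasSum_pi_prod_of_nonneg (fun a => rowLaw_nonneg hπ (hv a))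
    fun a => hasSum_rowLaw hπ₁ (hv a)
  rw [prod_const_one, ← (Equiv.curry A C ℕ).hasSum_iff] at this
  exact this

theorem ChiSqLE.tableLaw {v₀ v₁ : A → Ω → C → ℝ} {χ : ℝ} (hπ : ∀ ω, 0 ≤ π ω)
    (hv₀ : ∀ a ω c, 0 ≤ v₀ a ω c) (h : ∀ a, ChiSqLE (rowLaw π (v₀ a)) (rowLaw π (v₁ a)) χ) :
    ChiSqLE (tableLaw π v₀) (tableLaw π v₁) (Real.exp (Fintype.card A * χ) - 1) :=
  (ChiSqLE.pi (fun a => rowLaw_nonneg hπ (hv₀ a)) h).comp_equiv (Equiv.curry A C ℕ)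

variable [DecidableEq A]

/-- The means of a table whose row `a` has the means `v a (ω a)`, `ω a` being its state. -/
def tableMeans (v : A → Ω → C → ℝ) (ω : A → Ω) (d : A × C) : ℝ := v d.1 (ω d.1) d.2

theorem tableLaw_eq_sum (v : A → Ω → C → ℝ) (k : A × C → ℕ) :
    tableLaw π v k = ∑ ω : A → Ω, (∏ a, π (ω a)) * poissonLaw (tableMeans v ω) k := by
  simp only [tableLaw, rowLaw, poissonLaw, tableMeans, Fintype.prod_prod_type]
  rw [← sum_pi_prod]
  simp only [prod_mul_distrib]

variable [DecidableEq C] {N : ℕ}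

/-- The probability that `T` answers "yes" on Poissonized samples with the means `tableMeans v ω`,
the states `ω a` of the rows being independent with distribution `π`. -/
noncomputable def mixtureYesProb (π : Ω → ℝ) (v : A → Ω → C → ℝ) (T : RandomizedTest (A × C) N) :
    ℝ :=
  ∑ ω : A → Ω, (∏ a, π (ω a)) * poissonYesProb (tableMeans v ω) T

theorem hasSum_mixtureYesProb {v : A → Ω → C → ℝ} (hv : ∀ a ω c, 0 ≤ v a ω c)
    (T : RandomizedTest (A × C) N) :
    HasSum (fun x => shuffle (tableLaw π v) x * acceptProb T x) (mixtureYesProb π v T) := by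
  have component (ω : A → Ω) := hasSum_poissonYesProb (μ := tableMeans v ω)
    (fun d => hv d.1 (ω d.1) d.2) T
  refine (hasSum_sum fun ω _ => (component ω).mul_left (∏ a, π (ω a))).congr_fun fun x => ?_
  rw [shuffle, tableLaw_eq_sum, sum_div, sum_mul]
  exact sum_congr rfl fun ω _ => by rw [shuffle]; ring

theorem mixtureYesProb_sub_le (hπ : ∀ ω, 0 ≤ π ω) (hπ₁ : ∑ ω, π ω = 1) {v₀ v₁ : A → Ω → C → ℝ}
    (hv₀ : ∀ a ω c, 0 < v₀ a ω c) (hv₁ : ∀ a ω c, 0 ≤ v₁ a ω c) {χ δ : ℝ}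
    (h : ∀ a, ChiSqLE (rowLaw π (v₀ a)) (rowLaw π (v₁ a)) χ) (hδ : 0 < δ)
    (hχ : Real.exp (Fintype.card A * χ) - 1 ≤ δ ^ 2) (T : RandomizedTest (A × C) N) :
    mixtureYesProb π v₀ T - mixtureYesProb π v₁ T ≤ δ := by
  have hv₀' (a ω c) : 0 ≤ v₀ a ω c := (hv₀ a ω c).le
  have nonneg₀ := tableLaw_nonneg hπ hv₀'
  exact ChiSqLE.sub_le (((ChiSqLE.tableLaw hπ hv₀' h).mono hχ).shuffle nonneg₀) hδ
    (shuffle_pos (tableLaw_pos hπ hπ₁ hv₀)) (hasSum_shuffle nonneg₀ (hasSum_tableLaw hπ hπ₁ hv₀'))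
    (hasSum_shuffle (tableLaw_nonneg hπ hv₁) (hasSum_tableLaw hπ hπ₁ hv₁)) (acceptProb_nonneg T)
    (acceptProb_le_one T) (hasSum_mixtureYesProb hv₀' T) (hasSum_mixtureYesProb hv₁ T)

end RowMixture

section RowModel

variable {C Ψ : Type*} [Fintype C] {p l : ℝ} {φ : Ψ → C → ℝ}

/-- The Poisson means of a row with a given state: a heavy row is uniform of total mean `1`, while
a light row is the uniform row of total mean `l` modulated by the function `φ` of its pattern. -/
noncomputable def rowIntensity (l : ℝ) (φ : Ψ → C → ℝ) (ω : Bool × Ψ) (c : C) : ℝ :=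
  (if ω.1 then 1 else l * φ ω.2 c) / Fintype.card C

theorem rowIntensity_nonneg (hl : 0 ≤ l) (hφ : ∀ ψ c, 0 ≤ φ ψ c) (ω : Bool × Ψ) (c : C) :
    0 ≤ rowIntensity l φ ω c := by
  have := hφ ω.2 c
  unfold rowIntensity
  split_ifs <;> positivity

theorem rowIntensity_pos (hl : 0 < l) (hφ : ∀ ψ c, 0 < φ ψ c) (ω : Bool × Ψ) (c : C) :
    0 < rowIntensity l φ ω c := by
  have : Nonempty C := ⟨c⟩
  have := hφ ω.2 c
  have := Fintype.card_pos (α := C)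
  unfold rowIntensity
  split_ifs <;> positivity

theorem sum_rowIntensity [Nonempty C] (l : ℝ) (hφ : ∀ ψ, ∑ c, φ ψ c = Fintype.card C)
    (ω : Bool × Ψ) : ∑ c, rowIntensity l φ ω c = if ω.1 then 1 else l := by
  unfold rowIntensity
  rw [← sum_div]
  split_ifs
  · simp
  · rw [← mul_sum, hφ, mul_div_cancel_right₀ _ (by simp)]

variable [Fintype Ψ]

/-- The distribution of the state of a row: it is heavy (first component `true`) with probability
`p`, and independently carries a uniform pattern in `Ψ`. -/
noncomputable def rowPrior (p : ℝ) (ω : Bool × Ψ) : ℝ :=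
  (if ω.1 then p else 1 - p) / Fintype.card Ψ

theorem rowPrior_nonneg (hp₀ : 0 ≤ p) (hp₁ : p ≤ 1) (ω : Bool × Ψ) : 0 ≤ rowPrior p ω := by
  have := sub_nonneg.2 hp₁
  unfold rowPrior
  split_ifs <;> positivity

theorem sum_rowPrior_mul (p : ℝ) (f : Bool × Ψ → ℝ) :
    ∑ ω, rowPrior p ω * f ω = p * (𝔼 ψ, f (true, ψ)) + (1 - p) * 𝔼 ψ, f (false, ψ) := by
  simp only [Fintype.sum_prod_type, Fintype.sum_bool, rowPrior, ← mul_sum,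
    Fintype.expect_eq_sum_div_card, if_true, Bool.false_eq_true, if_false]
  ring

theorem sum_rowPrior [Nonempty Ψ] (p : ℝ) : ∑ ω : Bool × Ψ, rowPrior p ω = 1 := by
  simpa using sum_rowPrior_mul (Ψ := Ψ) p 1

/-- The likelihood ratio of the counts `κ` between a light row modulated by `φ` and an unmodulated
one of the same total mean, averaged over the pattern. -/
noncomputable def meanRatio (φ : Ψ → C → ℝ) (κ : C → ℕ) : ℝ := 𝔼 ψ, ∏ c, φ ψ c ^ κ c

theorem meanRatio_eq_one (hφ : ∀ c, 𝔼 ψ, φ ψ c = 1) {κ : C → ℕ} [Nonempty Ψ]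
    (hκ : ∑ c, κ c ≤ 1) : meanRatio φ κ = 1 := by
  by_cases h : ∃ c, κ c ≠ 0
  · obtain ⟨c, hc⟩ := h
    classical
    have split : κ c + ∑ d ∈ univ.erase c, κ d = ∑ d, κ d := add_sum_erase _ _ (mem_univ c)
    have others (d : C) (hd : d ≠ c) : κ d = 0 :=
      sum_eq_zero_iff.1 (by omega : ∑ d ∈ univ.erase c, κ d = 0) d (by simp [hd])
    have single (ψ : Ψ) : ∏ d, φ ψ d ^ κ d = φ ψ c := by
      rw [Fintype.prod_eq_single c fun d hd => by rw [others d hd, pow_zero],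
        show κ c = 1 by omega, pow_one]
    simp only [meanRatio, single, hφ]
  · push Not at h
    simp [meanRatio, h]

theorem hasSum_poissonLaw_mul_prod_pow {μ y : C → ℝ} (hμ : ∀ c, 0 ≤ μ c) (hy : ∀ c, 0 ≤ y c) :
    HasSum (fun κ => poissonLaw μ κ * ∏ c, y c ^ κ c) (Real.exp (∑ c, μ c * (y c - 1))) := by
  rw [Real.exp_sum]
  refine (hasSum_pi_prod_of_nonneg (fun c n => mul_nonneg (poissonWeight_nonneg (hμ c) n)
    (pow_nonneg (hy c) n)) fun c => hasSum_poissonWeight_mul_pow (μ c) (y c)).congr_fun fun κ => ?_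
  rw [poissonLaw, prod_mul_distrib]

theorem poissonLaw_mul (μ y : C → ℝ) (κ : C → ℕ) :
    poissonLaw (fun c => μ c * y c) κ =
      poissonLaw μ κ * (Real.exp (-∑ c, μ c * (y c - 1)) * ∏ c, y c ^ κ c) := by
  simp only [poissonLaw, ← sum_neg_distrib, Real.exp_sum, ← prod_mul_distrib]
  refine prod_congr rfl fun c _ => ?_
  rw [poissonWeight, poissonWeight, show -(μ c * y c) = -μ c + -(μ c * (y c - 1)) by ring,
    Real.exp_add]
  ring

/-- The law of independent Poisson counts, all of the same mean, with expected total `1`. -/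
noncomputable def uniformPoissonLaw (κ : C → ℕ) : ℝ :=
  poissonLaw (fun _ => (Fintype.card C : ℝ)⁻¹) κ

theorem uniformPoissonLaw_nonneg (κ : C → ℕ) : 0 ≤ uniformPoissonLaw κ :=
  poissonLaw_nonneg (fun _ => by positivity) κ

theorem hasSum_uniformPoissonLaw : HasSum (uniformPoissonLaw (C := C)) 1 :=
  hasSum_poissonLaw fun _ => by positivity

theorem rowLaw_rowIntensity [Nonempty C] [Nonempty Ψ] (p l : ℝ)
    (hφ : ∀ ψ, ∑ c, φ ψ c = Fintype.card C) (κ : C → ℕ) :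
    rowLaw (rowPrior p) (rowIntensity l φ) κ = uniformPoissonLaw κ *
      (p + (1 - p) * (Real.exp (1 - l) * l ^ (∑ c, κ c) * meanRatio φ κ)) := by
  have heavy (ψ : Ψ) : rowIntensity l φ (true, ψ) = fun _ => (Fintype.card C : ℝ)⁻¹ := by
    ext c
    simp [rowIntensity]
  have light (ψ : Ψ) : poissonLaw (rowIntensity l φ (false, ψ)) κ =
      uniformPoissonLaw κ * (Real.exp (1 - l) * l ^ (∑ c, κ c)) * ∏ c, φ ψ c ^ κ c := by
    have intensity : rowIntensity l φ (false, ψ) =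
        fun c => (Fintype.card C : ℝ)⁻¹ * (l * φ ψ c) := by
      ext c
      simp [rowIntensity, div_eq_inv_mul]
    have exponent : -∑ c, (Fintype.card C : ℝ)⁻¹ * (l * φ ψ c - 1) = 1 - l := by
      rw [← mul_sum, sum_sub_distrib, ← mul_sum, hφ]
      simp
      field_simp
      ring
    rw [intensity, poissonLaw_mul, exponent, uniformPoissonLaw]
    simp only [mul_pow, prod_mul_distrib, prod_pow_eq_pow_sum]
    ring
  rw [rowLaw, sum_rowPrior_mul]
  simp only [heavy, light, Fintype.expect_const, ← mul_expect, meanRatio, uniformPoissonLaw]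
  ring

theorem hasSum_expect {E ι : Type*} [Fintype ι] {f : ι → E → ℝ} {s : ι → ℝ}
    (h : ∀ i, HasSum (f i) (s i)) : HasSum (fun e => 𝔼 i, f i e) (𝔼 i, s i) := by
  simp only [Fintype.expect_eq_sum_div_card]
  exact (hasSum_sum fun i _ => h i).div_const _

theorem hasSum_uniformPoissonLaw_mul_meanRatio [Nonempty Ψ] (hφ₀ : ∀ ψ c, 0 ≤ φ ψ c)
    (hφ : ∀ ψ, ∑ c, φ ψ c = Fintype.card C) :
    HasSum (fun κ => uniformPoissonLaw κ * meanRatio φ κ) 1 := by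
  have exponent (ψ : Ψ) : ∑ c, (Fintype.card C : ℝ)⁻¹ * (φ ψ c - 1) = 0 := by
    rw [← mul_sum, sum_sub_distrib, hφ]
    simp
  simpa only [exponent, Real.exp_zero, Fintype.expect_const, ← mul_expect] using!
    hasSum_expect fun ψ => hasSum_poissonLaw_mul_prod_pow (μ := fun _ => (Fintype.card C : ℝ)⁻¹)
      (fun _ => by positivity) (hφ₀ ψ)

theorem hasSum_uniformPoissonLaw_mul_meanRatio_sq (hφ₀ : ∀ ψ c, 0 ≤ φ ψ c) :
    HasSum (fun κ => uniformPoissonLaw κ * meanRatio φ κ ^ 2)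
      (𝔼 ψ, 𝔼 ψ', Real.exp (∑ c, (Fintype.card C : ℝ)⁻¹ * (φ ψ c * φ ψ' c - 1))) := by
  refine (hasSum_expect fun ψ => hasSum_expect fun ψ' => hasSum_poissonLaw_mul_prod_pow
    (μ := fun _ => (Fintype.card C : ℝ)⁻¹) (fun _ => by positivity)
    fun c => mul_nonneg (hφ₀ ψ c) (hφ₀ ψ' c)).congr_fun fun κ => ?_
  simp only [mul_pow, prod_mul_distrib, ← mul_expect, meanRatio, sq, expect_mul_expect]
  rfl

theorem sq_rowLaw_sub_le [Nonempty C] [Nonempty Ψ] (hp₀ : 0 < p) (hp₁ : p ≤ 1) (hl₀ : 0 ≤ l)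
    (hl₁ : l ≤ 1) (hφ : ∀ ψ, ∑ c, φ ψ c = Fintype.card C) (hφ' : ∀ c, 𝔼 ψ, φ ψ c = 1)
    (κ : C → ℕ) :
    (rowLaw (rowPrior p) (rowIntensity l φ) κ -
        rowLaw (rowPrior p) (rowIntensity l (1 : Ψ → C → ℝ)) κ) ^ 2 ≤
      9 * l ^ 4 / p * (uniformPoissonLaw κ * (meanRatio φ κ - 1) ^ 2) *
        rowLaw (rowPrior p) (rowIntensity l (1 : Ψ → C → ℝ)) κ := by
  have meanRatio_one : meanRatio (1 : Ψ → C → ℝ) κ = 1 := by simp [meanRatio]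
  rw [rowLaw_rowIntensity p l hφ, rowLaw_rowIntensity (φ := 1) p l fun _ => by simp,
    meanRatio_one]
  have q_nonneg := uniformPoissonLaw_nonneg κ
  set q := uniformPoissonLaw κ
  set b := meanRatio φ κ with hb
  set w := Real.exp (1 - l) * l ^ ∑ c, κ c with hw
  have w_nonneg : 0 ≤ w := by positivity
  have invisible_or_small : w ^ 2 * (b - 1) ^ 2 ≤ 9 * l ^ 4 * (b - 1) ^ 2 := by
    rcases le_or_gt (∑ c, κ c) 1 with hκ | hκ
    · simp [hb, meanRatio_eq_one hφ' hκ]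
    · have exp_le : Real.exp (1 - l) ≤ 3 :=
        (Real.exp_le_exp.2 (by linarith)).trans Real.exp_one_lt_three.le
      calc w ^ 2 * (b - 1) ^ 2 ≤ (3 * l ^ 2) ^ 2 * (b - 1) ^ 2 := by
            rw [hw]
            gcongr ?_ ^ 2 * _
            exact mul_le_mul exp_le (pow_le_pow_of_le_one hl₀ hl₁ hκ) (by positivity) (by norm_num)
        _ = 9 * l ^ 4 * (b - 1) ^ 2 := by ring
  have sq_le_one : (1 - p) ^ 2 ≤ 1 := pow_le_one₀ (by linarith) (by linarith)
  have light_nonneg : 0 ≤ (1 - p) * (w * 1) := mul_nonneg (by linarith) (by linarith)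
  calc (q * (p + (1 - p) * (w * b)) - q * (p + (1 - p) * (w * 1))) ^ 2
      = (1 - p) ^ 2 * (q ^ 2 * (w ^ 2 * (b - 1) ^ 2)) := by ring
    _ ≤ 1 * (q ^ 2 * (9 * l ^ 4 * (b - 1) ^ 2)) := by gcongr
    _ = 9 * l ^ 4 / p * (q * (b - 1) ^ 2) * (q * p) := by field_simp
    _ ≤ 9 * l ^ 4 / p * (q * (b - 1) ^ 2) * (q * (p + (1 - p) * (w * 1))) := by
        gcongr
        linarith

theorem chiSqLE_rowLaw [Nonempty C] [Nonempty Ψ] (hp₀ : 0 < p) (hp₁ : p ≤ 1) (hl₀ : 0 < l)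
    (hl₁ : l ≤ 1) (hφ₀ : ∀ ψ c, 0 ≤ φ ψ c) (hφ : ∀ ψ, ∑ c, φ ψ c = Fintype.card C)
    (hφ' : ∀ c, 𝔼 ψ, φ ψ c = 1) :
    ChiSqLE (rowLaw (rowPrior p) (rowIntensity l (1 : Ψ → C → ℝ)))
      (rowLaw (rowPrior p) (rowIntensity l φ))
      (9 * l ^ 4 / p *
        ((𝔼 ψ, 𝔼 ψ', Real.exp (∑ c, (Fintype.card C : ℝ)⁻¹ * (φ ψ c * φ ψ' c - 1))) - 1)) := by
  have null_pos (ψ : Ψ) (c : C) : 0 < (1 : Ψ → C → ℝ) ψ c := one_pos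
  refine chiSqLE_of_sq_sub_le
    (rowLaw_pos (rowPrior_nonneg hp₀.le hp₁) (sum_rowPrior p) (rowIntensity_pos hl₀ null_pos))
    (hasSum_rowLaw (sum_rowPrior p) (rowIntensity_nonneg hl₀.le fun ψ c => (null_pos ψ c).le))
    (hasSum_rowLaw (sum_rowPrior p) (rowIntensity_nonneg hl₀.le hφ₀))
    (sq_rowLaw_sub_le hp₀ hp₁ hl₀.le hl₁ hφ hφ') (HasSum.mul_left (9 * l ^ 4 / p) ?_)
  have moments (M : ℝ) : M - 1 = M - 2 * 1 + 1 := by ring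
  rw [moments]
  exact (((hasSum_uniformPoissonLaw_mul_meanRatio_sq hφ₀).sub
    ((hasSum_uniformPoissonLaw_mul_meanRatio hφ₀ hφ).mul_left 2)).add
    hasSum_uniformPoissonLaw).congr_fun fun κ => by ring

end RowModel

section ColumnPattern

variable {K : Type*} [Fintype K]

/-- The modulation of a row by a pattern `r`: of each pair `(k, true)`, `(k, false)` of columns,
the intensity of `(k, r k)` is doubled and the other column is emptied. -/
def columnFactor (r : K → Bool) (c : K × Bool) : ℝ := if r c.1 = c.2 then 2 else 0

theorem columnFactor_nonneg {K : Type*} (r : K → Bool) (c : K × Bool) : 0 ≤ columnFactor r c := by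
  unfold columnFactor
  split_ifs <;> norm_num

theorem sum_columnFactor (r : K → Bool) : ∑ c, columnFactor r c = Fintype.card (K × Bool) := by
  simp [Fintype.sum_prod_type, columnFactor]

variable [DecidableEq K]

theorem expect_columnFactor (c : K × Bool) : 𝔼 r, columnFactor r c = 1 := by
  have half : ∑ _b : Bool, (1 / 2 : ℝ) = 1 := by norm_num [Fintype.sum_bool]
  have := sum_pi_prod_mul_apply half (fun b => if b = c.2 then (2 : ℝ) else 0) c.1
  simp only [prod_const, card_univ, ← mul_sum] at this
  rw [Fintype.expect_eq_sum_div_card]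
  simpa [columnFactor, div_eq_inv_mul] using this

theorem expect_exp_columnFactor_mul (x : ℝ) (r : K → Bool) :
    𝔼 r', Real.exp (∑ c, x * (columnFactor r c * columnFactor r' c - 1)) =
      Real.cosh (2 * x) ^ Fintype.card K := by
  have pair (r' : K → Bool) : ∑ c, x * (columnFactor r c * columnFactor r' c - 1) =
      ∑ k, if r' k = r k then 2 * x else -(2 * x) := by
    rw [Fintype.sum_prod_type]
    refine sum_congr rfl fun k _ => ?_
    cases hr : r k <;> cases hr' : r' k <;> simp [columnFactor, hr, hr'] <;> ring
  have factor (k : K) :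
      ∑ b, Real.exp (if b = r k then 2 * x else -(2 * x)) = 2 * Real.cosh (2 * x) := by
    rw [Fintype.sum_bool, Real.cosh_eq]
    cases r k <;> simp <;> ring
  simp only [pair, Real.exp_sum, Fintype.expect_eq_sum_div_card]
  rw [sum_pi_prod fun k b => Real.exp (if b = r k then 2 * x else -(2 * x))]
  simp only [factor, prod_const, card_univ, mul_pow, Fintype.card_fun, Fintype.card_bool,
    Nat.cast_pow, Nat.cast_ofNat]
  field_simp

theorem cosh_inv_pow_le {n : ℕ} (hn : 0 < n) : Real.cosh (n : ℝ)⁻¹ ^ n ≤ 1 + (n : ℝ)⁻¹ := by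
  have one_le : (1 : ℝ) ≤ n := by exact_mod_cast hn
  have abs_le : |(n : ℝ)⁻¹ / 2| ≤ 1 := by
    rw [abs_of_nonneg (by positivity)]
    linarith [inv_le_one_of_one_le₀ one_le]
  calc Real.cosh (n : ℝ)⁻¹ ^ n ≤ Real.exp ((n : ℝ)⁻¹ ^ 2 / 2) ^ n := by
        gcongr
        exact Real.cosh_le_exp_half_sq _
    _ = Real.exp ((n : ℝ)⁻¹ / 2) := by
        rw [← Real.exp_nat_mul]
        congr 1
        field_simp
    _ ≤ 1 + 2 * |(n : ℝ)⁻¹ / 2| := by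
        linarith [le_abs_self (Real.exp ((n : ℝ)⁻¹ / 2) - 1), Real.abs_exp_sub_one_le abs_le]
    _ = 1 + (n : ℝ)⁻¹ := by
        rw [abs_of_nonneg (by positivity)]
        ring

theorem chiSqLE_rowLaw_columnFactor [Nonempty K] {p l : ℝ} (hp₀ : 0 < p) (hp₁ : p ≤ 1)
    (hl₀ : 0 < l) (hl₁ : l ≤ 1) :
    ChiSqLE (rowLaw (rowPrior p) (rowIntensity l (1 : (K → Bool) → K × Bool → ℝ)))
      (rowLaw (rowPrior p) (rowIntensity l (columnFactor (K := K))))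
      (9 * l ^ 4 / (p * Fintype.card K)) := by
  refine (chiSqLE_rowLaw hp₀ hp₁ hl₀ hl₁ columnFactor_nonneg sum_columnFactor
    expect_columnFactor).mono ?_
  have two_mul_inv : 2 * (Fintype.card (K × Bool) : ℝ)⁻¹ = (Fintype.card K : ℝ)⁻¹ := by
    simp
  simp only [expect_exp_columnFactor_mul, two_mul_inv, Fintype.expect_const]
  calc 9 * l ^ 4 / p * (Real.cosh (Fintype.card K : ℝ)⁻¹ ^ Fintype.card K - 1)
      ≤ 9 * l ^ 4 / p * (1 + (Fintype.card K : ℝ)⁻¹ - 1) := by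
        gcongr
        exact cosh_inv_pow_le Fintype.card_pos
    _ = 9 * l ^ 4 / (p * Fintype.card K) := by
        field_simp
        ring

end ColumnPattern

section AlphabetRestriction

open Function

theorem sum_extend {D D' : Type*} [Fintype D] [Fintype D'] {F : D' → D} (hF : Injective F)
    (P : D' → ℝ) : ∑ d, extend F P 0 d = ∑ d', P d' :=
  (Fintype.sum_of_injective F hF _ _ (fun d hd => extend_apply' _ _ d hd)
    fun d' => (hF.extend_apply P 0 d').symm).symm

theorem extend_mem_stdSimplex {D D' : Type*} [Fintype D] [Fintype D'] {F : D' → D}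
    (hF : Injective F) {P : D' → ℝ} (hP : P ∈ stdSimplex ℝ D') :
    extend F P 0 ∈ stdSimplex ℝ D := by
  refine ⟨fun d => ?_, (sum_extend hF P).trans hP.2⟩
  by_cases hd : ∃ d', F d' = d
  · obtain ⟨d', rfl⟩ := hd
    rw [hF.extend_apply]
    exact hP.1 d'
  · rw [extend_apply' _ _ _ hd, Pi.zero_apply]

theorem hellingerSq_extend {D D' : Type*} [Fintype D] [Fintype D'] {F : D' → D}
    (hF : Injective F) (P Q : D' → ℝ) :
    hellingerSq (extend F P 0) (extend F Q 0) = hellingerSq P Q := by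
  unfold hellingerSq
  congr 1
  refine (Fintype.sum_of_injective F hF _ _ (fun d hd => ?_) fun d' => ?_).symm
  · simp [extend_apply' _ _ d hd]
  · rw [hF.extend_apply, hF.extend_apply]

theorem yesProb_extend {D D' : Type*} [Fintype D] [Fintype D'] {F : D' → D} (hF : Injective F)
    {N : ℕ} (T : RandomizedTest D N) (P : D' → ℝ) :
    yesProb (extend F P 0) T = yesProb P fun x : Fin N → D' => T (F ∘ x) := by
  refine (Fintype.sum_of_injective (F ∘ ·) hF.comp_left _ _ (fun x hx => ?_) fun x => ?_).symm
  · obtain ⟨i, hi⟩ : ∃ i, ¬∃ d', F d' = x i := by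
      by_contra! h
      choose y hy using h
      exact hx ⟨y, funext hy⟩
    rw [prod_eq_zero (mem_univ i) (extend_apply' _ _ _ hi), zero_mul]
  · simp [hF.extend_apply]

variable {A C C' : Type*} {e : C' → C}

theorem extend_prodMap_id_apply (he : Injective e) (P : A × C' → ℝ) (a : A) (c : C) :
    extend (Prod.map id e) P 0 (a, c) = extend e (fun c' => P (a, c')) 0 c := by
  by_cases hc : ∃ c', e c' = c
  · obtain ⟨c', rfl⟩ := hc
    rw [he.extend_apply]
    exact (injective_id.prodMap he).extend_apply P 0 (a, c')
  · rw [extend_apply' _ _ _ hc, extend_apply']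
    · rfl
    · rintro ⟨d, hd⟩
      exact hc ⟨d.2, (Prod.ext_iff.1 hd).2⟩

variable [Fintype A] [Fintype C] [Fintype C']

theorem marginalProduct_extend (he : Injective e) (P : A × C' → ℝ) :
    marginalProduct (extend (Prod.map (id : A → A) e) P 0) =
      extend (Prod.map id e) (marginalProduct P) 0 := by
  ext ⟨a, c⟩
  simp only [marginalProduct, marginalA, marginalC, extend_prodMap_id_apply he, sum_extend he]
  by_cases hc : ∃ c', e c' = c
  · obtain ⟨c', rfl⟩ := hc
    simp only [he.extend_apply]
  · simp [extend_apply' _ _ _ hc]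

theorem IsIndependenceTester.comap (he : Injective e) {N : ℕ} {ε : ℝ}
    {T : RandomizedTest (A × C) N} (hT : IsIndependenceTester ε T) :
    IsIndependenceTester ε fun x : Fin N → A × C' => T (Prod.map id e ∘ x) := by
  intro P hP
  have hF : Injective (Prod.map (id : A → A) e) := injective_id.prodMap he
  have := hT _ (extend_mem_stdSimplex hF hP)
  rwa [marginalProduct_extend he, hellingerSq_extend hF, yesProb_extend hF] at this

end AlphabetRestriction

section Hellinger

theorem sum_div_two_le_hellingerSq {D : Type*} [Fintype D] {P Q : D → ℝ} {s : Finset D}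
    (hP : ∀ d ∈ s, P d = 0) (hQ : ∀ d ∈ s, 0 ≤ Q d) : (∑ d ∈ s, Q d) / 2 ≤ hellingerSq P Q := by
  have on_s : ∑ d ∈ s, (√(P d) - √(Q d)) ^ 2 = ∑ d ∈ s, Q d :=
    sum_congr rfl fun d hd => by
      rw [hP d hd, Real.sqrt_zero, zero_sub, neg_sq, Real.sq_sqrt (hQ d hd)]
  rw [hellingerSq, ← on_s, one_div, div_eq_inv_mul]
  gcongr
  exact subset_univ s

theorem hellingerSq_marginalProduct_mul {A C : Type*} [Fintype A] [Fintype C] {f : A → ℝ}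
    {g : C → ℝ} (h : (fun d : A × C => f d.1 * g d.2) ∈ stdSimplex ℝ (A × C)) :
    hellingerSq (fun d : A × C => f d.1 * g d.2)
      (marginalProduct fun d : A × C => f d.1 * g d.2) = 0 := by
  have total : (∑ a, f a) * ∑ c, g c = 1 := by
    rw [sum_mul_sum, ← Fintype.sum_prod_type']
    exact h.2
  have product : (marginalProduct fun d : A × C => f d.1 * g d.2) = fun d => f d.1 * g d.2 := by
    ext d
    simp only [marginalProduct, marginalA, marginalC, ← mul_sum, ← sum_mul]
    linear_combination f d.1 * g d.2 * total
  simp [product, hellingerSq]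

end Hellinger

section TableModel

variable {A C Ψ : Type*} [Fintype C]

/-- The number of heavy rows. -/
def heavyCount [Fintype A] (ω : A → Bool × Ψ) : ℕ := #{a | (ω a).1}

variable [DecidableEq A] {a₀ : A} {R l : ℝ} {φ : Ψ → C → ℝ}

/-- The intensities of the rows of the hard instances: the row `a₀` is uniform of total mean `R`,
whatever its state, and the other rows follow `rowIntensity`. The null hypothesis corresponds to
the modulation `φ = 1`. -/
noncomputable def intensity (a₀ : A) (R l : ℝ) (φ : Ψ → C → ℝ) (a : A) (ω : Bool × Ψ) (c : C) : ℝ :=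
  if a = a₀ then R / Fintype.card C else rowIntensity l φ ω c

theorem intensity_nonneg (hR : 0 ≤ R) (hl : 0 ≤ l) (hφ : ∀ ψ c, 0 ≤ φ ψ c) (a : A)
    (ω : Bool × Ψ) (c : C) : 0 ≤ intensity a₀ R l φ a ω c := by
  unfold intensity
  split_ifs
  · positivity
  · exact rowIntensity_nonneg hl hφ ω c

theorem intensity_pos (hR : 0 < R) (hl : 0 < l) (hφ : ∀ ψ c, 0 < φ ψ c) (a : A)
    (ω : Bool × Ψ) (c : C) : 0 < intensity a₀ R l φ a ω c := by
  have : Nonempty C := ⟨c⟩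
  have := Fintype.card_pos (α := C)
  unfold intensity
  split_ifs
  · positivity
  · exact rowIntensity_pos hl hφ ω c

theorem intensity_one (a : A) (ω : Bool × Ψ) (c : C) :
    intensity a₀ R l 1 a ω c =
      (if a = a₀ then R else if ω.1 then 1 else l) * (Fintype.card C : ℝ)⁻¹ := by
  simp only [intensity, rowIntensity, Pi.one_apply, mul_one, div_eq_mul_inv, ite_mul]

theorem chiSqLE_rowLaw_intensity {χ : ℝ} {π : Bool × Ψ → ℝ} [Fintype Ψ] (hπ₁ : ∑ ω, π ω = 1)
    (hR : 0 ≤ R) (hχ : 0 ≤ χ)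
    (h : ChiSqLE (rowLaw π (rowIntensity l (1 : Ψ → C → ℝ))) (rowLaw π (rowIntensity l φ)) χ)
    (a : A) :
    ChiSqLE (rowLaw π (intensity a₀ R l 1 a)) (rowLaw π (intensity a₀ R l φ a)) χ := by
  by_cases ha : a = a₀
  · have row (φ' : Ψ → C → ℝ) : intensity a₀ R l φ' a = fun _ _ => R / Fintype.card C := by
      ext ω c
      simp [intensity, ha]
    rw [row, row]
    exact (chiSqLE_self (hasSum_rowLaw hπ₁ fun _ _ => by positivity)).mono hχ
  · have row (φ' : Ψ → C → ℝ) : intensity a₀ R l φ' a = rowIntensity l φ' := by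
      ext ω c
      simp [intensity, ha]
    rwa [row, row]

variable [Nonempty C]

theorem sum_intensity (R l : ℝ) (hφ : ∀ ψ, ∑ c, φ ψ c = Fintype.card C) (a : A) (ω : Bool × Ψ) :
    ∑ c, intensity a₀ R l φ a ω c = if a = a₀ then R else if ω.1 then 1 else l := by
  unfold intensity
  split_ifs with ha
  · rw [sum_const, card_univ, nsmul_eq_mul, mul_div_cancel₀ _ (by simp)]
  all_goals simp_all [sum_rowIntensity]

variable [Fintype A]

theorem le_sum_tableMeans (hl : 0 ≤ l) (hφ : ∀ ψ, ∑ c, φ ψ c = Fintype.card C)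
    (ω : A → Bool × Ψ) : R ≤ ∑ d, tableMeans (intensity a₀ R l φ) ω d := by
  simp only [Fintype.sum_prod_type, tableMeans, sum_intensity R l hφ]
  rw [← add_sum_erase univ _ (mem_univ a₀), if_pos rfl]
  refine le_add_of_nonneg_right (sum_nonneg fun a ha => ?_)
  rw [if_neg (ne_of_mem_erase ha)]
  split_ifs <;> positivity

theorem sum_tableMeans_le (hl : 0 ≤ l) (hφ : ∀ ψ, ∑ c, φ ψ c = Fintype.card C)
    (ω : A → Bool × Ψ) :
    ∑ d, tableMeans (intensity a₀ R l φ) ω d ≤ R + (heavyCount ω + Fintype.card A * l) := by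
  simp only [Fintype.sum_prod_type, tableMeans, sum_intensity R l hφ]
  rw [← add_sum_erase univ _ (mem_univ a₀), if_pos rfl]
  gcongr
  calc ∑ a ∈ univ.erase a₀, (if a = a₀ then R else if (ω a).1 then 1 else l)
      ≤ ∑ a ∈ univ.erase a₀, ((if (ω a).1 then 1 else 0) + l) := by
        refine sum_le_sum fun a ha => ?_
        rw [if_neg (ne_of_mem_erase ha)]
        split_ifs <;> linarith
    _ ≤ ∑ a, ((if (ω a).1 then 1 else 0) + l) := by
        refine sum_le_sum_of_subset_of_nonneg (subset_univ _) fun a _ _ => ?_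
        split_ifs <;> positivity
    _ = heavyCount ω + Fintype.card A * l := by
        simp [sum_add_distrib, heavyCount]

theorem hellingerSq_normalize_tableMeans_one (hR : 0 < R) (hl : 0 ≤ l) (ω : A → Bool × Ψ) :
    hellingerSq (normalize (tableMeans (intensity a₀ R l (1 : Ψ → C → ℝ)) ω))
      (marginalProduct (normalize (tableMeans (intensity a₀ R l (1 : Ψ → C → ℝ)) ω))) = 0 := by
  set Z := ∑ d, tableMeans (intensity a₀ R l (1 : Ψ → C → ℝ)) ω d with hZ
  have factorizes : normalize (tableMeans (intensity a₀ R l (1 : Ψ → C → ℝ)) ω) = fun d =>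
      ((if d.1 = a₀ then R else if (ω d.1).1 then 1 else l) / Z) * (Fintype.card C : ℝ)⁻¹ := by
    ext d
    rw [normalize, ← hZ, tableMeans, intensity_one]
    ring
  have Z_pos : 0 < Z := hR.trans_le (le_sum_tableMeans hl (fun ψ => by simp) ω)
  have mem : normalize (tableMeans (intensity a₀ R l (1 : Ψ → C → ℝ)) ω) ∈ stdSimplex ℝ (A × C) :=
    normalize_mem_stdSimplex
      (fun d => intensity_nonneg hR.le hl (fun _ _ => zero_le_one) d.1 (ω d.1) d.2) Z_pos
  rw [factorizes] at mem ⊢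
  exact hellingerSq_marginalProduct_mul
    (f := fun a => (if a = a₀ then R else if (ω a).1 then 1 else l) / Z)
    (g := fun _ => (Fintype.card C : ℝ)⁻¹) mem

end TableModel

section Separation

variable {A K : Type*} [DecidableEq A] [Fintype A]

/-- The rows modulated by their pattern, in the table of `intensity a₀ R l columnFactor`. -/
def lightRows (a₀ : A) (ω : A → Bool × (K → Bool)) : Finset A := {a | a ≠ a₀ ∧ ¬(ω a).1}

theorem card_le_card_lightRows_add (a₀ : A) (ω : A → Bool × (K → Bool)) :
    Fintype.card A ≤ #(lightRows a₀ ω) + (heavyCount ω + 1) := by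
  have cover : univ = lightRows a₀ ω ∪ (({a | (ω a).1} : Finset A) ∪ {a₀}) := by
    ext a
    simp only [lightRows, mem_union, mem_filter, mem_univ, true_and, mem_singleton, true_iff]
    tauto
  calc Fintype.card A = #(lightRows a₀ ω ∪ (({a | (ω a).1} : Finset A) ∪ {a₀})) := by
        rw [← cover, card_univ]
    _ ≤ #(lightRows a₀ ω) + (heavyCount ω + #{a₀}) :=
        (card_union_le _ _).trans (Nat.add_le_add_left (card_union_le _ _) _)

variable [Fintype K]

theorem card_columnFactor_eq_zero (r : K → Bool) :
    #{c : K × Bool | columnFactor r c = 0} = Fintype.card K := by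
  rw [card_filter, Fintype.sum_prod_type, ← card_univ, card_eq_sum_ones]
  refine sum_congr rfl fun k _ => ?_
  cases h : r k <;> simp [columnFactor, h]

variable {a₀ : A} {R l : ℝ} [Nonempty K]

theorem le_marginalProduct_of_mem_lightRows (hR : 0 < R) (hl : 0 ≤ l)
    {ω : A → Bool × (K → Bool)} {a : A} (ha : a ∈ lightRows a₀ ω) (c : K × Bool) :
    l * R / (Fintype.card (K × Bool) *
        (∑ d, tableMeans (intensity a₀ R l columnFactor) ω d) ^ 2) ≤
      marginalProduct (normalize (tableMeans (intensity a₀ R l columnFactor) ω)) (a, c) := by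
  obtain ⟨ha₀, light⟩ : a ≠ a₀ ∧ (ω a).1 = false := by simpa [lightRows] using ha
  set Z := ∑ d, tableMeans (intensity a₀ R l columnFactor) ω d
  have Z_pos : 0 < Z := hR.trans_le (le_sum_tableMeans hl sum_columnFactor ω)
  have row : marginalA (normalize (tableMeans (intensity a₀ R l columnFactor) ω)) a = l / Z := by
    change ∑ c, intensity a₀ R l columnFactor a (ω a) c / Z = l / Z
    rw [← sum_div, sum_intensity R l sum_columnFactor, if_neg ha₀, light]
    rfl
  have column : R / Fintype.card (K × Bool) / Z ≤
      marginalC (normalize (tableMeans (intensity a₀ R l columnFactor) ω)) c := by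
    refine le_of_eq_of_le ?_ (single_le_sum (fun a' _ => div_nonneg (intensity_nonneg hR.le hl
      columnFactor_nonneg a' (ω a') c) Z_pos.le) (mem_univ a₀))
    simp [intensity]
  calc l * R / (Fintype.card (K × Bool) * Z ^ 2) = l / Z * (R / Fintype.card (K × Bool) / Z) := by
        field_simp
    _ ≤ _ := by
        rw [marginalProduct, row]
        gcongr

theorem le_hellingerSq_normalize_tableMeans (hA : 2 ≤ Fintype.card A) (hR : 0 < R) (hl : 0 ≤ l)
    {ω : A → Bool × (K → Bool)} (hω : heavyCount ω + Fintype.card A * l ≤ R)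
    (hω' : (heavyCount ω : ℝ) ≤ Fintype.card A / 4) :
    Fintype.card A * l / (64 * R) ≤
      hellingerSq (normalize (tableMeans (intensity a₀ R l columnFactor) ω))
        (marginalProduct (normalize (tableMeans (intensity a₀ R l columnFactor) ω))) := by
  set P := normalize (tableMeans (intensity a₀ R l columnFactor) ω) with hP
  set Z := ∑ d, tableMeans (intensity a₀ R l columnFactor) ω d
  have Z_pos : 0 < Z := hR.trans_le (le_sum_tableMeans hl sum_columnFactor ω)
  have Z_le : Z ≤ 2 * R := by linarith [sum_tableMeans_le (a₀ := a₀) (R := R) hl sum_columnFactor ω]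
  let emptied : Finset (A × (K × Bool)) :=
    {d | d.1 ∈ lightRows a₀ ω ∧ columnFactor (ω d.1).2 d.2 = 0}
  have P_emptied : ∀ d ∈ emptied, P d = 0 := by
    intro d hd
    simp only [emptied, lightRows, mem_filter, mem_univ, true_and] at hd
    simp [hP, normalize, tableMeans, intensity, rowIntensity, hd]
  have mass : ∀ d ∈ emptied,
      l * R / (Fintype.card (K × Bool) * Z ^ 2) ≤ marginalProduct P d := fun d hd =>
    le_marginalProduct_of_mem_lightRows hR hl (mem_filter.1 hd).2.1 d.2
  have card_emptied : #emptied = #(lightRows a₀ ω) * Fintype.card K := by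
    rw [card_eq_sum_ones, sum_finset_product emptied (lightRows a₀ ω)
      (fun a => {c | columnFactor (ω a).2 c = 0}) fun d => by simp [emptied]]
    simp [card_columnFactor_eq_zero]
  have light_le : (Fintype.card A : ℝ) / 4 ≤ #(lightRows a₀ ω) := by
    have card_le : (Fintype.card A : ℝ) ≤ #(lightRows a₀ ω) + (heavyCount ω + 1) := by
      exact_mod_cast card_le_card_lightRows_add a₀ ω
    have two_le : (2 : ℝ) ≤ Fintype.card A := by exact_mod_cast hA
    linarith
  calc Fintype.card A * l / (64 * R)
      = Fintype.card A / 4 * (l * R / (2 * (2 * R) ^ 2)) / 2 := by field_simp; ring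
    _ ≤ #(lightRows a₀ ω) * (l * R / (2 * Z ^ 2)) / 2 := by gcongr
    _ = #emptied • (l * R / (Fintype.card (K × Bool) * Z ^ 2)) / 2 := by
        rw [card_emptied, nsmul_eq_mul, Fintype.card_prod, Fintype.card_bool]
        push_cast
        field_simp
    _ ≤ (∑ d ∈ emptied, marginalProduct P d) / 2 := by
        gcongr
        exact card_nsmul_le_sum _ _ _ mass
    _ ≤ hellingerSq P (marginalProduct P) := sum_div_two_le_hellingerSq P_emptied fun d hd =>
        le_trans (by positivity) (mass d hd)

end Separation

section TestOnMixtures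

variable {A K : Type*} [DecidableEq A] [Fintype A] {N : ℕ} {ε R l p : ℝ} {a₀ : A}

theorem sum_prod_rowPrior_mul_heavyCount {Ψ : Type*} [Fintype Ψ] [Nonempty Ψ] (p : ℝ) :
    ∑ ω : A → Bool × Ψ, (∏ a, rowPrior p (ω a)) * heavyCount ω = Fintype.card A * p := by
  have heavy_prob (a : A) :
      ∑ ω : A → Bool × Ψ, (∏ b, rowPrior p (ω b)) * (if (ω a).1 then 1 else 0) = p := by
    rw [sum_pi_prod_mul_apply (sum_rowPrior p) (fun ω => if ω.1 then (1 : ℝ) else 0) a,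
      sum_rowPrior_mul]
    simp
  simp only [heavyCount, card_filter, Nat.cast_sum, Nat.cast_ite, Nat.cast_one, Nat.cast_zero,
    mul_sum]
  rw [sum_comm, sum_congr rfl fun a _ => heavy_prob a, sum_const, card_univ, nsmul_eq_mul]

theorem IsIndependenceTester.le_mixtureYesProb {C Ψ : Type*} [Fintype C] [DecidableEq C]
    [Nonempty C] [Fintype Ψ] [Nonempty Ψ] {T : RandomizedTest (A × C) N}
    (hT : IsIndependenceTester ε T) (hp₀ : 0 ≤ p) (hp₁ : p ≤ 1) (hl : 0 ≤ l)
    (hR : 2 * (N : ℝ) + 10 ≤ R) :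
    5 / 9 ≤ mixtureYesProb (rowPrior p) (intensity a₀ R l (1 : Ψ → C → ℝ)) T := by
  have R_pos : 0 < R := by linarith [N.cast_nonneg (α := ℝ)]
  have yes_prob (ω : A → Bool × Ψ) :
      5 / 9 ≤ poissonYesProb (tableMeans (intensity a₀ R l (1 : Ψ → C → ℝ)) ω) T := by
    have means_nonneg : ∀ d, 0 ≤ tableMeans (intensity a₀ R l (1 : Ψ → C → ℝ)) ω d := fun d =>
      intensity_nonneg R_pos.le hl (fun _ _ => zero_le_one) d.1 (ω d.1) d.2
    have total : R ≤ ∑ d, tableMeans (intensity a₀ R l (1 : Ψ → C → ℝ)) ω d :=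
      le_sum_tableMeans hl (fun _ => by simp) ω
    have accepted := (hT _ (normalize_mem_stdSimplex means_nonneg (R_pos.trans_le total))).1
      (hellingerSq_normalize_tableMeans_one R_pos hl ω)
    linarith [yesProb_mul_le_poissonYesProb means_nonneg (hR.trans total) T]
  calc (5 / 9 : ℝ) = ∑ ω : A → Bool × Ψ, (∏ a, rowPrior p (ω a)) * (5 / 9) := by
        rw [← sum_mul, sum_pi_prod_eq_one (sum_rowPrior p), one_mul]
    _ ≤ _ := sum_le_sum fun ω _ => mul_le_mul_of_nonneg_left (yes_prob ω)
        (prod_nonneg fun a _ => rowPrior_nonneg hp₀ hp₁ (ω a))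

variable [Fintype K] [Nonempty K] [DecidableEq K] {T : RandomizedTest (A × (K × Bool)) N} {s : ℝ}

theorem IsIndependenceTester.poissonYesProb_le (hT : IsIndependenceTester ε T)
    (hA : 2 ≤ Fintype.card A) (hR : 0 < R) (hl : 0 ≤ l) (hε : 64 * R * ε ≤ Fintype.card A * l)
    (hlR : 2 * (Fintype.card A * l) ≤ R) (hs : 0 < s) (hsR : 2 * s ≤ R)
    (hsA : 4 * s ≤ Fintype.card A) (ω : A → Bool × (K → Bool)) :
    poissonYesProb (tableMeans (intensity a₀ R l columnFactor) ω) T ≤ 1 / 3 + heavyCount ω / s := by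
  have means_nonneg : ∀ d, 0 ≤ tableMeans (intensity a₀ R l columnFactor) ω d := fun d =>
    intensity_nonneg hR.le hl columnFactor_nonneg d.1 (ω d.1) d.2
  have total_pos : 0 < ∑ d, tableMeans (intensity a₀ R l columnFactor) ω d :=
    hR.trans_le (le_sum_tableMeans hl sum_columnFactor ω)
  have mem := normalize_mem_stdSimplex means_nonneg total_pos
  refine (poissonYesProb_le_yesProb means_nonneg total_pos T).trans ?_
  rcases le_or_gt (heavyCount ω : ℝ) s with few | many
  · have far := le_hellingerSq_normalize_tableMeans (a₀ := a₀) hA hR hl (ω := ω)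
      (by linarith) (by linarith)
    have rejected := (hT _ mem).2 (le_trans ((le_div_iff₀ (by positivity)).2 (by linarith)) far)
    have : 0 ≤ heavyCount ω / s := by positivity
    linarith
  · have : 1 ≤ heavyCount ω / s := (one_le_div hs).2 many.le
    linarith [yesProb_le_one mem T]

theorem IsIndependenceTester.mixtureYesProb_le (hT : IsIndependenceTester ε T)
    (hA : 2 ≤ Fintype.card A) (hR : 0 < R) (hl : 0 ≤ l) (hε : 64 * R * ε ≤ Fintype.card A * l)
    (hlR : 2 * (Fintype.card A * l) ≤ R) (hs : 0 < s) (hsR : 2 * s ≤ R)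
    (hsA : 4 * s ≤ Fintype.card A) (hp₀ : 0 ≤ p) (hp₁ : p ≤ 1) :
    mixtureYesProb (rowPrior p) (intensity a₀ R l columnFactor) T ≤
      1 / 3 + Fintype.card A * p / s :=
  calc mixtureYesProb (rowPrior p) (intensity a₀ R l columnFactor) T
      ≤ ∑ ω : A → Bool × (K → Bool), (∏ a, rowPrior p (ω a)) * (1 / 3 + heavyCount ω / s) :=
        sum_le_sum fun ω _ => mul_le_mul_of_nonneg_left
          (hT.poissonYesProb_le hA hR hl hε hlR hs hsR hsA ω)
          (prod_nonneg fun a _ => rowPrior_nonneg hp₀ hp₁ (ω a))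
    _ = 1 / 3 + Fintype.card A * p / s := by
        rw [← sum_prod_rowPrior_mul_heavyCount (Ψ := K → Bool) p, sum_div]
        simp only [mul_add, sum_add_distrib, mul_div_assoc]
        rw [← sum_mul, sum_pi_prod_eq_one (sum_rowPrior p), one_mul]

theorem mixtureYesProb_intensity_sub_le (hp₀ : 0 < p) (hp₁ : p ≤ 1) (hR : 0 < R) (hl₀ : 0 < l)
    (hl₁ : l ≤ 1) (hχ : Fintype.card A * (9 * l ^ 4 / (p * Fintype.card K)) ≤ 1 / 26)
    (T : RandomizedTest (A × (K × Bool)) N) :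
    mixtureYesProb (rowPrior p) (intensity a₀ R l (1 : (K → Bool) → K × Bool → ℝ)) T -
      mixtureYesProb (rowPrior p) (intensity a₀ R l columnFactor) T ≤ 1 / 5 := by
  refine mixtureYesProb_sub_le (rowPrior_nonneg hp₀.le hp₁) (sum_rowPrior p)
    (intensity_pos hR hl₀ fun _ _ => zero_lt_one)
    (intensity_nonneg hR.le hl₀.le columnFactor_nonneg)
    (chiSqLE_rowLaw_intensity (sum_rowPrior p) hR.le (by positivity)
      (chiSqLE_rowLaw_columnFactor hp₀ hp₁ hl₀ hl₁)) (by norm_num) ?_ T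
  calc Real.exp (Fintype.card A * (9 * l ^ 4 / (p * Fintype.card K))) - 1
      ≤ Real.exp (1 / 26) - 1 := by gcongr
    _ ≤ 1 / (1 - 1 / 26) - 1 := by
        gcongr
        exact Real.exp_bound_div_one_sub_of_interval (by norm_num) (by norm_num)
    _ = (1 / 5) ^ 2 := by norm_num

end TestOnMixtures

theorem not_isIndependenceTester {A K : Type*} [Fintype A] [Fintype K] [Nonempty K] {N : ℕ}
    {ε R l : ℝ} (hA : 2 ≤ Fintype.card A) (hR : 2 * (N : ℝ) + 10 ≤ R) (hl₀ : 0 < l) (hl₁ : l ≤ 1)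
    (hε : 64 * R * ε ≤ Fintype.card A * l) (hlR : 2 * (Fintype.card A * l) ≤ R)
    (hχ : 93600 * ((Fintype.card A : ℝ) ^ 2 * l ^ 4) ≤ min R (Fintype.card A) * Fintype.card K)
    (T : RandomizedTest (A × (K × Bool)) N) : ¬IsIndependenceTester ε T := by
  classical
  intro hT
  have R_pos : 0 < R := by linarith [N.cast_nonneg (α := ℝ)]
  have card_pos : 0 < Fintype.card A := by omega
  obtain ⟨a₀⟩ : Nonempty A := Fintype.card_pos_iff.1 card_pos
  set n : ℝ := (Fintype.card A : ℝ) with hn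
  have n_pos : 0 < n := Nat.cast_pos.2 card_pos
  have : 0 < min R n := lt_min R_pos n_pos
  -- A hundred times the expected number of heavy rows is at most `min R n / 4`.
  set p : ℝ := min R n / (400 * n) with hp
  have p_pos : 0 < p := by positivity
  have p_le : p ≤ 1 := (div_le_one (by positivity)).2 (by linarith [min_le_right R n])
  have χ_le : n * (9 * l ^ 4 / (p * Fintype.card K)) ≤ 1 / 26 := by
    have : n * (9 * l ^ 4 / (p * Fintype.card K)) =
        3600 * (n ^ 2 * l ^ 4) / (min R n * Fintype.card K) := by
      rw [hp]
      field_simp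
      norm_num
    rw [this, div_le_iff₀ (by positivity)]
    linarith
  have heavy_le : n * p / (min R n / 4) = 1 / 100 := by
    rw [hp]
    field_simp
    norm_num
  have null_yes := hT.le_mixtureYesProb (Ψ := K → Bool) (a₀ := a₀) p_pos.le p_le hl₀.le hR
  have alternative_yes := hT.mixtureYesProb_le (a₀ := a₀) (s := min R n / 4) hA R_pos hl₀.le hε hlR
    (by positivity) (by linarith [min_le_left R n]) (by linarith [min_le_right R n]) p_pos.le p_le
  have close := mixtureYesProb_intensity_sub_le (a₀ := a₀) p_pos p_le R_pos hl₀ hl₁ χ_le T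
  rw [← hn, heavy_le] at alternative_yes
  linarith

section Rate

/-- The order of the lower bound on the sample complexity, for alphabets of sizes `x` and `y`. -/
noncomputable def rate (x y ε : ℝ) : ℝ :=
  min (x ^ (3 / 4 : ℝ) * y ^ (1 / 4 : ℝ) / ε) (x ^ (2 / 3 : ℝ) * y ^ (1 / 3 : ℝ) / ε ^ (4 / 3 : ℝ))

theorem rpow_pow_eq_pow {x r : ℝ} (hx : 0 ≤ x) {k n : ℕ} (h : r * n = k) : (x ^ r) ^ n = x ^ k := by
  rw [← Real.rpow_mul_natCast hx, h, Real.rpow_natCast]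

variable {x y ε : ℝ}

theorem rate_nonneg (hx : 0 ≤ x) (hy : 0 ≤ y) (hε : 0 ≤ ε) : 0 ≤ rate x y ε :=
  le_min (by positivity) (by positivity)

theorem rate_pow_four_mul_le (hx : 0 ≤ x) (hy : 0 ≤ y) (hε : 0 < ε) :
    rate x y ε ^ 4 * ε ^ 4 ≤ x ^ 3 * y :=
  calc rate x y ε ^ 4 * ε ^ 4 ≤ (x ^ (3 / 4 : ℝ) * y ^ (1 / 4 : ℝ) / ε) ^ 4 * ε ^ 4 := by
        gcongr
        exacts [rate_nonneg hx hy hε.le, min_le_left _ _]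
    _ = x ^ 3 * y := by
        rw [div_pow, mul_pow, rpow_pow_eq_pow hx (k := 3) (by norm_num),
          rpow_pow_eq_pow hy (k := 1) (by norm_num), pow_one, div_mul_cancel₀ _ (by positivity)]

theorem rate_pow_three_mul_le (hx : 0 ≤ x) (hy : 0 ≤ y) (hε : 0 < ε) :
    rate x y ε ^ 3 * ε ^ 4 ≤ x ^ 2 * y :=
  calc rate x y ε ^ 3 * ε ^ 4
      ≤ (x ^ (2 / 3 : ℝ) * y ^ (1 / 3 : ℝ) / ε ^ (4 / 3 : ℝ)) ^ 3 * ε ^ 4 := by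
        gcongr
        exacts [rate_nonneg hx hy hε.le, min_le_right _ _]
    _ = x ^ 2 * y := by
        rw [div_pow, mul_pow, rpow_pow_eq_pow hx (k := 2) (by norm_num),
          rpow_pow_eq_pow hy (k := 1) (by norm_num), pow_one,
          rpow_pow_eq_pow hε.le (k := 4) (by norm_num), div_mul_cancel₀ _ (by positivity)]

theorem one_div_le_rate (hx : 1 ≤ x) (hy : 1 ≤ y) (hε₀ : 0 < ε) (hε₁ : ε ≤ 1) :
    1 / ε ≤ rate x y ε := by
  have one_le {r s : ℝ} (hr : 0 ≤ r) (hs : 0 ≤ s) : 1 ≤ x ^ r * y ^ s :=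
    one_le_mul_of_one_le_of_one_le (Real.one_le_rpow hx hr) (Real.one_le_rpow hy hs)
  have rpow_le : ε ^ (4 / 3 : ℝ) ≤ ε := Real.rpow_le_self_of_le_one hε₀.le hε₁ (by norm_num)
  refine le_min ?_ ?_
  · gcongr
    exact one_le (by norm_num) (by norm_num)
  · gcongr
    exact one_le (by norm_num) (by norm_num)

theorem rate_mul_pow_four_le (hx : 0 ≤ x) (hy : 0 ≤ y) (hε : 0 < ε) :
    (rate x y ε * ε) ^ 4 ≤ min (rate x y ε) x * (x ^ 2 * y) := by
  rw [mul_pow, min_mul_of_nonneg _ _ (by positivity)]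
  refine le_min ?_ ?_
  · calc rate x y ε ^ 4 * ε ^ 4 = rate x y ε * (rate x y ε ^ 3 * ε ^ 4) := by ring
      _ ≤ rate x y ε * (x ^ 2 * y) :=
          mul_le_mul_of_nonneg_left (rate_pow_three_mul_le hx hy hε) (rate_nonneg hx hy hε.le)
  · calc rate x y ε ^ 4 * ε ^ 4 ≤ x ^ 3 * y := rate_pow_four_mul_le hx hy hε
      _ = x * (x ^ 2 * y) := by ring

theorem rate_mul_le (hy : 0 ≤ y) (hyx : y ≤ x) (hε : 0 < ε) : rate x y ε * ε ≤ x := by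
  have hx : 0 ≤ x := hy.trans hyx
  refine le_of_pow_le_pow_left₀ (n := 4) (by norm_num) hx ?_
  calc (rate x y ε * ε) ^ 4 ≤ min (rate x y ε) x * (x ^ 2 * y) := rate_mul_pow_four_le hx hy hε
    _ ≤ x * (x ^ 2 * x) := by
        gcongr
        exact min_le_right _ _
    _ = x ^ 4 := by ring

theorem pow_four_rate_mul_div_le (hx : 0 < x) (hy : 0 ≤ y) (hε : 0 < ε) {k : ℝ}
    (hk : y ≤ 3 * k) :
    93600 * (x ^ 2 * (64 * (rate x y ε / 100000) * ε / x) ^ 4) ≤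
      min (rate x y ε / 100000) x * k := by
  have := rate_nonneg hx.le hy hε.le
  calc 93600 * (x ^ 2 * (64 * (rate x y ε / 100000) * ε / x) ^ 4)
      = 93600 * (64 / 100000) ^ 4 * (rate x y ε * ε) ^ 4 / x ^ 2 := by field_simp
    _ ≤ 93600 * (64 / 100000) ^ 4 * (min (rate x y ε) x * (x ^ 2 * y)) / x ^ 2 := by
        gcongr
        exact rate_mul_pow_four_le hx.le hy hε
    _ = 93600 * (64 / 100000) ^ 4 * (min (rate x y ε) x * y) := by field_simp
    _ ≤ 1 / 300000 * (min (rate x y ε) x * (3 * k)) := by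
        gcongr
        norm_num
    _ = min (rate x y ε) x / 100000 * k := by ring
    _ ≤ min (rate x y ε / 100000) x * k := by
        have : 0 ≤ k := by linarith
        gcongr
        refine le_min ?_ ?_
        · gcongr
          exact min_le_left _ _
        · linarith [min_le_right (rate x y ε) x]

end Rate

section SampleComplexity

variable {dA dC N : ℕ} {ε : ℝ}

theorem exists_injective_fin_div_two (d : ℕ) :
    ∃ e : Fin (d / 2) × Bool → Fin d, Function.Injective e := by
  obtain ⟨e⟩ := Function.Embedding.nonempty_of_card_le (α := Fin (d / 2) × Bool) (β := Fin d)
    (by simpa using Nat.div_mul_le_self d 2)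
  exact ⟨e, e.injective⟩

theorem IsIndependenceTester.rate_le (hC : 2 ≤ dC) (hCA : dC ≤ dA) (hε₀ : 0 < ε)
    (hε₁ : ε ≤ 1 / 2000000) {T : RandomizedTest (Fin dA × Fin dC) N}
    (hT : IsIndependenceTester ε T) : 1 / 400000 * rate dA dC ε ≤ N := by
  by_contra! too_few
  obtain ⟨e, he⟩ := exists_injective_fin_div_two dC
  have : Nonempty (Fin (dC / 2)) := ⟨⟨0, by omega⟩⟩
  have dC_pos : (1 : ℝ) ≤ dC := by exact_mod_cast (by omega : 1 ≤ dC)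
  have dC_le_dA : (dC : ℝ) ≤ dA := by exact_mod_cast hCA
  have dA_pos : (1 : ℝ) ≤ dA := dC_pos.trans dC_le_dA
  have dC_le : (dC : ℝ) ≤ 3 * (dC / 2 : ℕ) := by exact_mod_cast (by omega : dC ≤ 3 * (dC / 2))
  set B := rate dA dC ε
  have B_large : 2000000 ≤ B :=
    ((le_div_iff₀ hε₀).2 (by linarith)).trans (one_div_le_rate dA_pos dC_pos hε₀ (by linarith))
  have B_mul_le : B * ε ≤ dA := rate_mul_le (by linarith) dC_le_dA hε₀
  refine not_isIndependenceTester (A := Fin dA) (K := Fin (dC / 2)) (ε := ε) (R := B / 100000)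
    (l := 64 * (B / 100000) * ε / dA) ?_ (by linarith) (by positivity) ?_ ?_ ?_ ?_ _ (hT.comap he)
  · rw [Fintype.card_fin]
    omega
  · rw [div_le_one (by positivity)]
    linarith
  · rw [Fintype.card_fin, mul_div_cancel₀ _ (by positivity)]
  · rw [Fintype.card_fin, mul_div_cancel₀ _ (by positivity)]
    nlinarith
  · rw [Fintype.card_fin, Fintype.card_fin]
    exact pow_four_rate_mul_div_le (by linarith) (by linarith) hε₀ dC_le

theorem ofReal_rate_le_sampleComplexity (hC : 2 ≤ dC) (hCA : dC ≤ dA) (hε₀ : 0 < ε)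
    (hε₁ : ε ≤ 1 / 2000000) :
    ENNReal.ofReal (1 / 400000 * rate dA dC ε) ≤ (sampleComplexity ε dA dC : ENNReal) := by
  have le_ceil : ((⌈1 / 400000 * rate dA dC ε⌉₊ : ℕ) : ℕ∞) ≤ sampleComplexity ε dA dC :=
    le_iInf₂ fun N ⟨T, hT⟩ => Nat.cast_le.2 (Nat.ceil_le.2 (hT.rate_le hC hCA hε₀ hε₁))
  calc ENNReal.ofReal (1 / 400000 * rate dA dC ε)
      ≤ ENNReal.ofReal ⌈1 / 400000 * rate dA dC ε⌉₊ := ENNReal.ofReal_le_ofReal (Nat.le_ceil _)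
    _ = ((⌈1 / 400000 * rate dA dC ε⌉₊ : ℕ) : ℕ∞) := by simp
    _ ≤ sampleComplexity ε dA dC := by exact_mod_cast le_ceil

end SampleComplexity

end IndependenceTesting

theorem mainTheorem6_general {dA dC : ℕ} {ε : ℝ} (hC : 2 ≤ dC) (hCA : dC ≤ dA) (hε₀ : 0 < ε)
    (hε₁ : ε ≤ 1 / 2000000) :
    ENNReal.ofReal
      (1 / 400000 * min ((dA : ℝ) ^ (3 / 4 : ℝ) * (dC : ℝ) ^ (1 / 4 : ℝ) / ε)
        ((dA : ℝ) ^ (2 / 3 : ℝ) * (dC : ℝ) ^ (1 / 3 : ℝ) / ε ^ (4 / 3 : ℝ)))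
    ≤ (IndependenceTesting.sampleComplexity ε dA dC : ℝ≥0∞) :=
  IndependenceTesting.ofReal_rate_le_sampleComplexity hC hCA hε₀ hε₁

theorem mainTheorem6 :
    ∃ c : ℝ, 0 < c ∧ ∃ k : ℕ, ∃ ε₀ : ℝ, 0 < ε₀ ∧ ε₀ ≤ 1 ∧
      ∀ (dA dC : ℕ) (ε : ℝ), 2 ≤ dC → dC ≤ dA → 0 < ε → ε ≤ ε₀ →
        ENNReal.ofReal
          (c * min ((dA : ℝ) ^ (3 / 4 : ℝ) * (dC : ℝ) ^ (1 / 4 : ℝ) / ε)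
                   ((dA : ℝ) ^ (2 / 3 : ℝ) * (dC : ℝ) ^ (1 / 3 : ℝ) / ε ^ (4 / 3 : ℝ))
            / Real.log ((dA : ℝ) * (dC : ℝ) / ε) ^ k)
        ≤ (IndependenceTesting.sampleComplexity ε dA dC : ℝ≥0∞) := by
  refine ⟨1 / 400000, by norm_num, 0, 1 / 2000000, by norm_num, by norm_num, ?_⟩
  intro dA dC ε hC hCA hε₀ hε₁
  rw [pow_zero, div_one]
  exact mainTheorem6_general hC hCA hε₀ hε₁
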